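/- **Conventions.** Let $\mathbf{\Delta}$ be the site whose objects are the closed subsets $S$ of the standard simplices $\Delta^n$ ($n\ge 0$), whose morphisms are all continuous maps, and whose coverings are the finite closed coverings. A *quasitopological space* is a sheaf of sets on this site; they form the cartesian closed category $\mathbf{qTop}$. For a topological space $X$, $\mathrm{Sing}^q(X)$ is the quasitopological space $S\mapsto C(S,X)$. The realization of a simplicial set in $\mathbf{qTop}$ is the sheafification of its left Kan extension realization, i.e. of the colimit-preserving functor sending the simplicial set $\Delta^n$ to the presheaf represented by the space $\Delta^n$. A morphism of $\mathbf{qTop}$ is a *fibration* if it has the right lifting property with respect to the realizations of all horn inclusions $\Lambda^n_i\hookrightarrow\Delta^n$, $n\ge 1$, $0\le i\le n$. Let $B$ be a topological space. A *continuous sheaf* on $B$ is a $\mathbf{qTop}$-valued sheaf on $B$. For a continuous sheaf $\mathcal F$ and compact $K\subset B$ put $\mathcal F(K)=\varinjlim_{U\supset K}\mathcal F(U)$ (colimit in $\mathbf{qTop}$ over the open $U\supset K$). A morphism $f:\mathcal F\to\mathcal G$ of continuous sheaves is a *flexible extension* if for all compact subsets $K\subset L$ of $B$ the induced morphism $$\mathcal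 F(L)\longrightarrow \mathcal F(K)\times_{\mathcal G(K)}\mathcal G(L)$$ is a fibration; $\mathcal F$ is *flexible* if the morphism from $\mathcal F$ to the terminal sheaf is a flexible extension. The *sheaf of formal sections* $\mathcal F^*$ of $\mathcal F$ is the sheafification (as a $\mathbf{qTop}$-valued sheaf on $B$) of the presheaf $U\mapsto \mathcal F(U)^{\mathrm{Sing}^q(U)}$; it is functorial in $\mathcal F$. The *mapping track* of a morphism $g:\mathcal A\to\mathcal C$ of continuous sheaves is the morphism $\mathcal A\times_{\mathcal C}\mathcal C^{[0,1]}\to\mathcal C$ given by evaluation of paths at $1$, where $\mathcal C^{[0,1]}$ is the sheaf $U\mapsto\mathcal C(U)^{\mathrm{Sing}^q([0,1])}$ and the fibre product is formed with evaluation at $0$. The *flexible track* of $f:\mathcal F\to\mathcal G$ is the mapping track $\mathcal F^*\times_{\mathcal G^*}(\mathcal G^*)^{[0,1]}\to\mathcal G^*$ of the induced morphism $\mathcal F^*\to\mathcal G^*$. **Lemma.** Let $B$ be a normal Hausdorff space. For every morphism $f:\mathcal F\to\mathcal G$ of continuous sheaves on $B$, the flexible track of $f$ is a flexible extension. In particular,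 for every continuous sheaf $\mathcal F$ on $B$, the sheaf $\mathcal F^*$ of formal sections of $\mathcal F$ is flexible. -/

import Mathlib

open CategoryTheory Limits Opposite MonoidalCategory TopologicalSpace

universe u

noncomputable section

/-! ## The small site of closed subsets of simplices -/

/-- A closed subset of a standard simplex `Δ^n`, `n ≥ 0`. -/
structure SingDelta : Type where
  dim : ℕ
  carrier : Set (stdSimplex ℝ (Fin (dim + 1)))
  isClosed : IsClosed carrier

namespace SingDelta

instance : CoeSort SingDelta Type := ⟨fun S => S.carrier⟩

/-- Morphisms are all continuous maps. -/
instance : SmallCategory SingDelta where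
  Hom S T := C(S, T)
  id S := ContinuousMap.id S
  comp f g := g.comp f

/-- The continuous map underlying a morphism. -/
def toMap {S T : SingDelta} (f : S ⟶ T) : C(S, T) := f

/-- The morphism given by a continuous map. -/
def ofMap {S T : SingDelta} (f : C(S, T)) : S ⟶ T := f

/-- A family of closed subsets `C i`, `i < k`, of the simplex containing `S`, with union `S`. -/
structure FiniteClosedCover (S : SingDelta) where
  k : ℕ
  C : Fin k → Set (stdSimplex ℝ (Fin (S.dim + 1)))
  isClosed : ∀ i, IsClosed (C i)
  iUnion_eq : ⋃ i, C i = S.carrier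

namespace FiniteClosedCover

variable {S : SingDelta} (c : S.FiniteClosedCover)

lemma subset (i : Fin c.k) : c.C i ⊆ S.carrier := by
  rw [← c.iUnion_eq]
  exact Set.subset_iUnion c.C i

lemma exists_mem (p : S) : ∃ i, p.1 ∈ c.C i := by
  simpa only [← c.iUnion_eq, Set.mem_iUnion] using p.2

/-- The `i`-th member of the covering. -/
def piece (i : Fin c.k) : SingDelta := ⟨S.dim, c.C i, c.isClosed i⟩

/-- The inclusion of the `i`-th member. -/
def ι (i : Fin c.k) : c.piece i ⟶ S :=
  ofMap ⟨Set.inclusion (c.subset i), continuous_inclusion _⟩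

/-- The family of inclusions of the members of the covering. -/
def presieve : Presieve S := Presieve.ofArrows c.piece c.ι

/-- The preimage of a finite closed covering under a continuous map. -/
def pullback {T : SingDelta} (f : T ⟶ S) : T.FiniteClosedCover where
  k := c.k
  C i := Subtype.val '' {x : T | (toMap f x).1 ∈ c.C i}
  isClosed i := T.isClosed.isClosedEmbedding_subtypeVal.isClosedMap _
    ((c.isClosed i).preimage (continuous_subtype_val.comp (toMap f).continuous))
  iUnion_eq := by
    ext x
    simp only [Set.mem_iUnion, Set.mem_image, Set.mem_ofPred_eq]
    constructor
    · rintro ⟨_, y, _, rfl⟩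
      exact y.2
    · intro hx
      obtain ⟨i, hi⟩ := c.exists_mem (toMap f ⟨x, hx⟩)
      exact ⟨i, ⟨x, hx⟩, hi, rfl⟩

end FiniteClosedCover

/-- The coverings of an object are its finite closed coverings. -/
def coverage : Coverage SingDelta where
  coverings S := {R | ∃ c : S.FiniteClosedCover, R = c.presieve}
  pullback := by
    rintro S T f _ ⟨c, rfl⟩
    refine ⟨_, ⟨c.pullback f, rfl⟩, ?_⟩
    rintro _ _ ⟨i⟩
    have h : ∀ x : (c.pullback f).piece i,
        (toMap f (toMap ((c.pullback f).ι i) x)).1 ∈ c.C i := by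
      rintro ⟨_, ⟨y, hy, rfl⟩⟩
      exact hy
    exact ⟨c.piece i, ofMap ⟨fun x => ⟨_, h x⟩, (continuous_subtype_val.comp
      ((toMap f).continuous.comp (toMap ((c.pullback f).ι i)).continuous)).subtype_mk _⟩,
      c.ι i, ⟨i⟩, rfl⟩

/-- The Grothendieck topology of finite closed coverings. -/
def topology : GrothendieckTopology SingDelta := coverage.toGrothendieck

end SingDelta

/-! ## Quasitopological spaces -/

/-- Prequasitopological spaces: presheaves of sets on the site of closed subsets of simplices. -/
abbrev PqTop : Type (u + 1) := SingDeltaᵒᵖ ⥤ Type u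

/-- Quasitopological spaces: sheaves of sets on the site of closed subsets of simplices. -/
abbrev QTop : Type (u + 1) := Sheaf SingDelta.topology (Type u)

/-- The monoidal structure on quasitopological spaces is the cartesian one. -/
instance : MonoidalCategory QTop.{u} :=
  (inferInstance : CartesianMonoidalCategory QTop.{u}).toMonoidalCategory

instance : MonoidalCategoryStruct QTop.{u} :=
  (inferInstance : MonoidalCategory QTop.{u}).toMonoidalCategoryStruct

/-- Quasitopological spaces form a cartesian closed category. -/
instance : MonoidalClosed QTop.{u} :=
  instMonoidalClosedSheafOfHasSheafifyOfFunctorOpposite SingDelta.topology (Type u)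

instance : HasColimits QTop.{u} := CategoryTheory.Sheaf.instHasColimitsOfSize

/-- The prequasitopological space `S ↦ {continuous maps S → X}`, functorially in `X`. -/
def singPre : TopCat.{u} ⥤ PqTop.{u} where
  obj X :=
    { obj S := C(S.unop, X)
      map f := ↾fun s => ContinuousMap.comp s (SingDelta.toMap f.unop) }
  map f := { app S := ↾fun s => f.hom.comp s }

lemma isSheaf_iff_forall_cover (P : PqTop.{u}) :
    Presheaf.IsSheaf SingDelta.topology P ↔
      ∀ (S : SingDelta) (c : S.FiniteClosedCover), Presieve.IsSheafFor P c.presieve := by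
  rw [isSheaf_iff_isSheaf_of_type, SingDelta.topology, Presieve.isSheaf_coverage]
  constructor
  · exact fun h S c => h _ ⟨c, rfl⟩
  · rintro h S _ ⟨c, rfl⟩
    exact h S c

lemma singPre_isSheaf (X : TopCat.{u}) :
    Presheaf.IsSheaf SingDelta.topology (singPre.obj X) := by
  rw [isSheaf_iff_forall_cover]
  intro S c
  rw [SingDelta.FiniteClosedCover.presieve, Presieve.isSheafFor_arrows_iff]
  intro (x : ∀ i, C(c.piece i, X)) hx
  have key : ∀ (p : S) i j (hi : p.1 ∈ c.C i) (hj : p.1 ∈ c.C j),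
      x i ⟨p.1, hi⟩ = x j ⟨p.1, hj⟩ := by
    intro p i j hi hj
    have h := hx i j ⟨S.dim, {p.1}, isClosed_singleton⟩
      (SingDelta.ofMap ⟨fun q => ⟨p.1, hi⟩, continuous_const⟩)
      (SingDelta.ofMap ⟨fun q => ⟨p.1, hj⟩, continuous_const⟩) rfl
    exact congrArg (fun s : C(({p.1} : Set _), X) => s ⟨p.1, rfl⟩) h
  choose i hi using c.exists_mem
  let f : S → X := fun p => x (i p) ⟨p.1, hi p⟩
  have hf : Continuous f := by
    refine (locallyFinite_of_finite fun j : Fin c.k => {p : S | p.1 ∈ c.C j}).continuous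
      ?_ ?_ ?_
    · ext p
      simpa using ⟨i p, hi p⟩
    · exact fun j => (c.isClosed j).preimage continuous_subtype_val
    · intro j
      rw [continuousOn_iff_continuous_domRestrict]
      have : ({p : S | p.1 ∈ c.C j}).domRestrict f =
          fun p => x j ⟨p.1.1, p.2⟩ := by
        ext p
        exact key p.1 _ _ _ _
      rw [this]
      exact (x j).continuous.comp
        ((continuous_subtype_val.comp continuous_subtype_val).subtype_mk _)
  refine ⟨(⟨f, hf⟩ : C(S, X)), fun j => ?_, fun (g : C(S, X)) hg => ?_⟩
  · refine ContinuousMap.ext fun p => ?_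
    exact key ⟨p.1, c.subset j p.2⟩ _ _ _ _
  · refine ContinuousMap.ext fun p => ?_
    exact congrArg (fun s : C(c.piece (i p), X) => s ⟨p.1, hi p⟩) (hg (i p))

/-- The functor `X ↦ Sing^q(X)` from topological spaces to quasitopological spaces. -/
def singQ : TopCat.{u} ⥤ QTop.{u} where
  obj X := ⟨singPre.obj X, singPre_isSheaf X⟩
  map f := ⟨singPre.map f⟩


/-! ## Continuous sheaves and their sheafification -/

namespace SingDelta.FiniteClosedCover

variable {S : SingDelta} (c : S.FiniteClosedCover)

/-- The intersection of two members of the covering. -/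
def inter (i j : Fin c.k) : SingDelta := ⟨S.dim, c.C i ∩ c.C j, (c.isClosed i).inter (c.isClosed j)⟩

/-- The members of the covering and their pairwise intersections. -/
def index : MulticospanIndex ⟨Fin c.k, Fin c.k × Fin c.k, Prod.fst, Prod.snd⟩ SingDeltaᵒᵖ where
  left i := op (c.piece i)
  right j := op (c.inter j.1 j.2)
  fst j := (ofMap (S := c.inter j.1 j.2) (T := c.piece j.1)
    ⟨Set.inclusion Set.inter_subset_left, continuous_inclusion _⟩).op
  snd j := (ofMap (S := c.inter j.1 j.2) (T := c.piece j.2)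
    ⟨Set.inclusion Set.inter_subset_right, continuous_inclusion _⟩).op

/-- The inclusions of the members of the covering, which agree on the intersections. -/
def fork : Multifork c.index :=
  Multifork.ofι _ (op S) (fun i => (c.ι i).op) (fun _ => rfl)

lemma isSheafFor_iff (P : PqTop.{u}) :
    Presieve.IsSheafFor P c.presieve ↔ Nonempty (IsLimit (P.mapCone c.fork)) := by
  rw [Types.isLimit_iff, presieve, Presieve.isSheafFor_arrows_iff]
  have fstEq (s : ∀ j, (c.index.multicospan ⋙ P).obj j) (hs : s ∈ (c.index.multicospan ⋙ P).sections)
      (i j : Fin c.k) : P.map (c.index.fst (i, j)) (s (.left i)) = s (.right (i, j)) :=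
    hs (WalkingMulticospan.Hom.fst
        (J := ⟨Fin c.k, Fin c.k × Fin c.k, Prod.fst, Prod.snd⟩) (i, j))
  have sndEq (s : ∀ j, (c.index.multicospan ⋙ P).obj j) (hs : s ∈ (c.index.multicospan ⋙ P).sections)
      (i j : Fin c.k) : P.map (c.index.snd (i, j)) (s (.left j)) = s (.right (i, j)) :=
    hs (WalkingMulticospan.Hom.snd
        (J := ⟨Fin c.k, Fin c.k × Fin c.k, Prod.fst, Prod.snd⟩) (i, j))
  constructor
  · intro h s hs
    obtain ⟨t, ht, hu⟩ := h (fun i => s (.left i)) (fun i j Z gi gj hg => by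
      have hm : ∀ z : Z, (toMap gi z).1 ∈ c.C i ∩ c.C j := fun z => ⟨(toMap gi z).2, by
        have h1 : (toMap gi z).1 = (toMap gj z).1 :=
          congrArg (fun q : S => q.1) (congrArg (fun f => toMap f z) hg)
        rw [h1]
        exact (toMap gj z).2⟩
      let l : Z ⟶ c.inter i j := ofMap ⟨fun z => ⟨(toMap gi z).1, hm z⟩,
        (continuous_subtype_val.comp (toMap gi).continuous).subtype_mk _⟩
      have hj : gj.op = c.index.snd (i, j) ≫ l.op :=
        congrArg Quiver.Hom.op (ContinuousMap.ext fun z => Subtype.ext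
          (congrArg (fun f => (toMap f z).1) hg).symm)
      calc P.map gi.op (s (.left i))
        _ = P.map l.op (P.map (c.index.fst (i, j)) (s (.left i))) :=
          P.map_comp_apply (c.index.fst (i, j)) l.op _
        _ = P.map l.op (P.map (c.index.snd (i, j)) (s (.left j))) :=
          congrArg (P.map l.op) ((fstEq s hs i j).trans (sndEq s hs i j).symm)
        _ = P.map (c.index.snd (i, j) ≫ l.op) (s (.left j)) :=
          (P.map_comp_apply (c.index.snd (i, j)) l.op _).symm
        _ = P.map gj.op (s (.left j)) := congrArg (fun g => P.map g (s (.left j))) hj.symm)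
    refine ⟨t, ?_, fun t' ht' => hu t' fun i => ht' (.left i)⟩
    rintro (i | ⟨i, j⟩)
    · exact ht i
    · rw [← fstEq s hs i j, ← ht i]
      exact P.map_comp_apply (c.ι i).op (c.index.fst (i, j)) t
  · intro h x hx
    let s : ∀ j, (c.index.multicospan ⋙ P).obj j
      | .left i => x i
      | .right p => P.map (c.index.fst p) (x p.1)
    have hs : s ∈ (c.index.multicospan ⋙ P).sections := by
      rintro _ _ (_ | p | p)
      · exact P.map_id_apply _ _
      · rfl
      · exact (hx p.1 p.2 (c.inter p.1 p.2) (c.index.fst p).unop (c.index.snd p).unop rfl).symm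
    obtain ⟨t, ht, hu⟩ := h s hs
    refine ⟨t, fun i => ht (.left i), fun t' ht' => hu t' ?_⟩
    rintro (i | ⟨i, j⟩)
    · exact ht' i
    · refine Eq.trans ?_ (congrArg (P.map (c.index.fst (i, j))) (ht' i))
      exact P.map_comp_apply (c.ι i).op (c.index.fst (i, j)) t'

end SingDelta.FiniteClosedCover

/-- Continuous sheaves on `B`: sheaves on `B` with values in quasitopological spaces. -/
abbrev ContSheaf (B : TopCat.{u}) : Type (u + 1) := Sheaf (Opens.grothendieckTopology B) QTop.{u}

/-- Continuous presheaves on `B`: presheaves on `B` with values in quasitopological spaces. -/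
abbrev ContPresheaf (B : TopCat.{u}) : Type (u + 1) := (Opens B)ᵒᵖ ⥤ QTop.{u}

namespace ContPresheaf

variable {B : TopCat.{u}}

/-- `S ↦ P[S]`, where `P[S](U) = P(U)[S]`. -/
abbrev slices (P : ContPresheaf B) : SingDeltaᵒᵖ ⥤ (Opens B)ᵒᵖ ⥤ Type u :=
  (P ⋙ sheafToPresheaf _ _).flip

/-- `S ↦` the sheafification of the presheaf of sets `P[S]` on `B`. -/
abbrev sheafifiedSlices (P : ContPresheaf B) : SingDeltaᵒᵖ ⥤ (Opens B)ᵒᵖ ⥤ Type u :=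
  P.slices ⋙ presheafToSheaf (Opens.grothendieckTopology B) (Type u) ⋙ sheafToPresheaf _ _

lemma isSheaf_sheafifiedSlices (P : ContPresheaf B) (U : (Opens B)ᵒᵖ) :
    Presheaf.IsSheaf SingDelta.topology (P.sheafifiedSlices.flip.obj U) := by
  rw [isSheaf_iff_forall_cover]
  intro S c
  rw [c.isSheafFor_iff]
  let L : ((Opens B)ᵒᵖ ⥤ Type u) ⥤ Type u :=
    presheafToSheaf (Opens.grothendieckTopology B) (Type u) ⋙ sheafToPresheaf _ _ ⋙
      (evaluation _ _).obj U
  have h : IsLimit (P.slices.mapCone c.fork) := evaluationJointlyReflectsLimits _ fun V =>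
    ((c.isSheafFor_iff _).1 ((isSheaf_iff_forall_cover _).1 (P.obj V).property S c)).some
  exact ⟨isLimitOfPreserves L h⟩

/-- The objectwise sheafification of a continuous presheaf, as a continuous presheaf. -/
def sheafified (P : ContPresheaf B) : ContPresheaf B :=
  ObjectProperty.lift _ P.sheafifiedSlices.flip P.isSheaf_sheafifiedSlices

lemma isSheaf_sheafified (P : ContPresheaf B) :
    Presheaf.IsSheaf (Opens.grothendieckTopology B) P.sheafified := by
  rw [Presheaf.isSheaf_iff_isSheaf_comp _ _ (sheafToPresheaf _ _), Presheaf.isSheaf_iff_isLimit]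
  intro U R hR
  refine ⟨evaluationJointlyReflectsLimits _ fun S => ?_⟩
  exact ((Presheaf.isSheaf_iff_isLimit _ _).1
    ((presheafToSheaf (Opens.grothendieckTopology B) (Type u)).obj (P.slices.obj S)).property
      R hR).some

/-- The canonical morphism from a continuous presheaf to its objectwise sheafification. -/
def toSheafified (P : ContPresheaf B) : P ⟶ P.sheafified where
  app U := ⟨{
    app S := (toSheafify (Opens.grothendieckTopology B) (P.slices.obj S)).app U
    naturality S T f := congrArg (fun t => t.app U)
      (toSheafify_naturality (Opens.grothendieckTopology B) (P.slices.map f)) }⟩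
  naturality U V i := by
    ext1
    ext1
    funext S
    exact (toSheafify (Opens.grothendieckTopology B) (P.slices.obj S)).naturality i

lemma isSheaf_slices (G : ContSheaf B) (S : SingDeltaᵒᵖ) :
    Presheaf.IsSheaf (Opens.grothendieckTopology B) ((slices G.obj).obj S) := by
  have h := (Presheaf.isSheaf_iff_isSheaf_comp _ _ (sheafToPresheaf _ _)).1 G.property
  rw [Presheaf.isSheaf_iff_isLimit] at h ⊢
  exact fun U R hR => ⟨isLimitOfPreserves ((evaluation _ _).obj S) (h R hR).some⟩

/-- The morphism `P[S] ⟶ Q[S]` induced by a morphism `P ⟶ Q`. -/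
def sliceMap {P Q : ContPresheaf B} (f : P ⟶ Q) : P.slices ⟶ Q.slices where
  app S := { app U := (f.app U).hom.app S
             naturality U V i := congrArg (fun t => t.hom.app S) (f.naturality i) }
  naturality S T g := by
    ext1
    funext U
    exact (f.app U).hom.naturality g

/-- The extension to the objectwise sheafification of a morphism to a continuous sheaf. -/
def sheafifiedLift (P : ContPresheaf B) (G : ContSheaf B) (f : P ⟶ G.obj) :
    P.sheafified ⟶ G.obj where
  app U := ⟨{
    app S := (sheafifyLift (Opens.grothendieckTopology B) ((sliceMap f).app S)
      (isSheaf_slices G S)).app U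
    naturality S T g := by
      refine congrArg (fun t => t.app U) (?_ :
        sheafifyMap (Opens.grothendieckTopology B) (P.slices.map g) ≫
          sheafifyLift (Opens.grothendieckTopology B) ((sliceMap f).app T) (isSheaf_slices G T) =
        sheafifyLift (Opens.grothendieckTopology B) ((sliceMap f).app S) (isSheaf_slices G S) ≫
          (slices G.obj).map g)
      apply sheafify_hom_ext _ _ _ (isSheaf_slices G T)
      rw [← Category.assoc, ← toSheafify_naturality, Category.assoc, toSheafify_sheafifyLift,
        ← Category.assoc, toSheafify_sheafifyLift]
      exact (sliceMap f).naturality g }⟩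
  naturality U V i := by
    ext1
    ext1
    funext S
    exact (sheafifyLift (Opens.grothendieckTopology B) ((sliceMap f).app S)
      (isSheaf_slices G S)).naturality i

lemma toSheafified_lift (P : ContPresheaf B) (G : ContSheaf B) (f : P ⟶ G.obj) :
    P.toSheafified ≫ P.sheafifiedLift G f = f := by
  ext1
  funext U
  ext1
  ext1
  funext S
  exact congrArg (fun t => t.app U) (toSheafify_sheafifyLift (Opens.grothendieckTopology B)
    ((sliceMap f).app S) (isSheaf_slices G S))

lemma sheafified_hom_ext (P : ContPresheaf B) (G : ContSheaf B) (g g' : P.sheafified ⟶ G.obj)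
    (h : P.toSheafified ≫ g = P.toSheafified ≫ g') : g = g' := by
  ext1
  funext U
  ext1
  ext1
  funext S
  refine congrArg (fun t => t.app U) (sheafify_hom_ext (Opens.grothendieckTopology B)
    ((sliceMap g).app S : sheafify (Opens.grothendieckTopology B) (P.slices.obj S) ⟶ _)
    ((sliceMap g').app S) (isSheaf_slices G S) ?_)
  ext1
  funext V
  exact congrArg (fun t => (t.app V).hom.app S) h

/-- Morphisms from the objectwise sheafification to a continuous sheaf are the morphisms from the
given continuous presheaf. -/
def homEquiv (P : ContPresheaf B) (G : ContSheaf B) :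
    ((⟨P.sheafified, P.isSheaf_sheafified⟩ : ContSheaf B) ⟶ G) ≃
      (P ⟶ (sheafToPresheaf _ _).obj G) where
  toFun g := P.toSheafified ≫ g.hom
  invFun f := ⟨P.sheafifiedLift G f⟩
  left_inv g := by
    ext1
    exact P.sheafified_hom_ext G _ _ (P.toSheafified_lift G _)
  right_inv f := P.toSheafified_lift G f

end ContPresheaf

/-- The inclusion of continuous sheaves into continuous presheaves has a left adjoint. -/
instance (B : TopCat.{u}) : HasWeakSheafify (Opens.grothendieckTopology B) QTop.{u} :=
  ⟨_, ⟨Adjunction.adjunctionOfEquivLeft ContPresheaf.homEquiv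
    (fun P _ _ g h => (Category.assoc P.toSheafified h.hom g.hom).symm)⟩⟩

/-! ## Fibrations of quasitopological spaces -/

/-- The inclusion of the simplicial category: `[n] ↦ Δ^n`, with affine maps. -/
def simplexInclusion : SimplexCategory ⥤ SingDelta where
  obj n := ⟨n.len, Set.univ, isClosed_univ⟩
  map f := SingDelta.ofMap ⟨fun x => ⟨stdSimplex.map f x.1, trivial⟩,
    ((stdSimplex.continuous_map f).comp continuous_subtype_val).subtype_mk _⟩
  map_id _ := ContinuousMap.ext fun x => Subtype.ext (stdSimplex.map_id_apply x.1)
  map_comp f g := ContinuousMap.ext fun x => Subtype.ext (stdSimplex.map_comp_apply f g x.1).symm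

/-- The realization of simplicial sets as prequasitopological spaces: the left Kan extension along
the Yoneda embedding of the functor sending `[n]` to the presheaf represented by `Δ^n`. -/
def realizationPre : SSet.{u} ⥤ PqTop.{u} :=
  uliftYoneda.{u}.leftKanExtension (simplexInclusion ⋙ uliftYoneda.{u})

/-- The realization of simplicial sets as quasitopological spaces. -/
def realization : SSet.{u} ⥤ QTop.{u} :=
  realizationPre ⋙ presheafToSheaf SingDelta.topology (Type u)

/-- The generating acyclic cofibrations: realizations of the horn inclusions `Λ^n_i → Δ^n`,
`n ≥ 1`. -/
def generatingAcyclicCofibrations : MorphismProperty QTop.{u} :=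
  ⨆ n : ℕ, .ofHoms fun i : Fin (n + 2) => realization.map (SSet.horn.{u} (n + 1) i).ι

/-- Fibrations: morphisms with the right lifting property with respect to the generating acyclic
cofibrations. -/
def IsQFibration {X Y : QTop.{u}} (p : X ⟶ Y) : Prop :=
  generatingAcyclicCofibrations.rlp p

/-! ## Flexible extensions and flexible sheaves -/

variable {B : TopCat.{u}}

/-- Open neighbourhoods of a subset, ordered by inclusion. -/
abbrev OpenNbhds (K : Set B) : Type u := {U : Opens B // K ⊆ U}

/-- The diagram of the quasitopological spaces `F(U)`, `U` an open neighbourhood of `K`. -/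
abbrev nbhdDiagram (F : ContSheaf B) (K : Set B) : (OpenNbhds K)ᵒᵖ ⥤ QTop.{u} :=
  (Subtype.mono_coe fun U : Opens B => K ⊆ U).functor.op ⋙ F.obj

/-- `F(K)`, the colimit of `F(U)` over the open neighbourhoods `U` of `K`. -/
def sectionsOn (F : ContSheaf B) (K : Set B) : QTop.{u} := colimit (nbhdDiagram F K)

/-- The morphism `f_K : F(K) ⟶ G(K)` induced by a morphism `f : F ⟶ G`. -/
def sectionsOnMap {F G : ContSheaf B} (f : F ⟶ G) (K : Set B) : sectionsOn F K ⟶ sectionsOn G K :=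
  colimMap (Functor.whiskerLeft (Subtype.mono_coe fun U : Opens B => K ⊆ U).functor.op f.hom)

/-- An open neighbourhood of `L` is an open neighbourhood of `K`, for `K ⊆ L`. -/
def nbhdsOfSubset {K L : Set B} (h : K ⊆ L) : OpenNbhds L ⥤ OpenNbhds K :=
  Monotone.functor (f := fun U => ⟨U.1, h.trans U.2⟩) fun _ _ hUV => hUV

/-- The restriction `F(L) ⟶ F(K)`, for `K ⊆ L`. -/
def restriction (F : ContSheaf B) {K L : Set B} (h : K ⊆ L) : sectionsOn F L ⟶ sectionsOn F K :=
  colimit.pre (nbhdDiagram F K) (nbhdsOfSubset h).op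

lemma restriction_comp_map {F G : ContSheaf B} (f : F ⟶ G) {K L : Set B} (h : K ⊆ L) :
    restriction F h ≫ sectionsOnMap f K = sectionsOnMap f L ≫ restriction G h := by
  refine colimit.hom_ext fun U => ?_
  let V : (OpenNbhds K)ᵒᵖ := (nbhdsOfSubset h).op.obj U
  have h₁ : colimit.ι (nbhdDiagram F L) U ≫ restriction F h = colimit.ι (nbhdDiagram F K) V :=
    colimit.ι_pre (nbhdDiagram F K) (nbhdsOfSubset h).op U
  have h₂ : colimit.ι (nbhdDiagram G L) U ≫ restriction G h = colimit.ι (nbhdDiagram G K) V :=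
    colimit.ι_pre (nbhdDiagram G K) (nbhdsOfSubset h).op U
  have h₃ : colimit.ι (nbhdDiagram F K) V ≫ sectionsOnMap f K =
      f.hom.app (op U.unop.1) ≫ colimit.ι (nbhdDiagram G K) V := ι_colimMap _ _
  have h₄ : colimit.ι (nbhdDiagram F L) U ≫ sectionsOnMap f L =
      f.hom.app (op U.unop.1) ≫ colimit.ι (nbhdDiagram G L) U := ι_colimMap _ _
  refine (Category.assoc _ _ _).symm.trans ((congrArg (· ≫ _) h₁).trans (h₃.trans ?_))
  refine Eq.trans ?_ ((congrArg (· ≫ _) h₄).symm.trans (Category.assoc _ _ _))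
  exact (congrArg (_ ≫ ·) h₂).symm.trans (Category.assoc _ _ _).symm

/-- The morphism `F(L) ⟶ F(K) ×_{G(K)} G(L)` induced by `f : F ⟶ G`, for `K ⊆ L`. -/
def relativeRestriction {F G : ContSheaf B} (f : F ⟶ G) {K L : Set B} (h : K ⊆ L) :
    sectionsOn F L ⟶ pullback (sectionsOnMap f K) (restriction G h) :=
  pullback.lift (restriction F h) (sectionsOnMap f L) (restriction_comp_map f h)

/-- `f : F ⟶ G` is a flexible extension if `F(L) ⟶ F(K) ×_{G(K)} G(L)` is a fibration for all
compact `K ⊆ L`. -/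
def IsFlexibleExtension {F G : ContSheaf B} (f : F ⟶ G) : Prop :=
  ∀ (K L : Set B), IsCompact K → IsCompact L → ∀ h : K ⊆ L, IsQFibration (relativeRestriction f h)

/-- `F` is flexible if the unique morphism to the terminal sheaf is a flexible extension. -/
def IsFlexible (F : ContSheaf B) : Prop := IsFlexibleExtension (terminal.from F)

/-! ## The sheaf of formal sections -/

/-- The presheaf `U ↦ F(U)^{Sing^q(U)}`, with the exponential of quasitopological spaces. -/
def formalPresheaf : ContSheaf B ⥤ ContPresheaf B where
  obj F :=
    { obj U := (ihom (singQ.obj ((Opens.toTopCat B).obj U.unop))).obj (F.obj.obj U)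
      map i := (ihom _).map (F.obj.map i) ≫
        (MonoidalClosed.pre (singQ.map ((Opens.toTopCat B).map i.unop))).app _
      map_id U := by
        simp
      map_comp i j := by
        simp }
  map f :=
    { app U := (ihom _).map (f.hom.app U)
      naturality U V i := by
        simp [← Functor.map_comp] }

/-- The sheaf `F^*` of formal sections of `F`: the sheafification of `U ↦ F(U)^{Sing^q(U)}`. -/
def formalSections : ContSheaf B ⥤ ContSheaf B :=
  formalPresheaf ⋙ presheafToSheaf (Opens.grothendieckTopology B) QTop.{u}

/-! ## The mapping track and the flexible track -/

/-- The unit interval as a quasitopological space. -/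
def qInterval : QTop.{u} := singQ.obj (TopCat.of (ULift.{u} unitInterval))

/-- The constant morphism to the unit interval with value `t`. -/
def qIntervalConst (t : unitInterval) (X : QTop.{u}) : X ⟶ qInterval.{u} :=
  ⟨{ app S := ↾fun _ => (ContinuousMap.const S.unop (ULift.up t) : C(S.unop, ULift unitInterval)) }⟩

/-- Evaluation of paths at `t`, as morphisms `X^[0,1] ⟶ X` natural in `X`. -/
def evalPath (t : unitInterval) : ihom qInterval.{u} ⟶ 𝟭 QTop.{u} where
  app X := CartesianMonoidalCategory.lift (qIntervalConst t _) (𝟙 _) ≫ (ihom.ev qInterval.{u}).app X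
  naturality X Y f := by
    have h : (ihom qInterval.{u}).map f ≫
        CartesianMonoidalCategory.lift (qIntervalConst.{u} t _) (𝟙 _) =
        CartesianMonoidalCategory.lift (qIntervalConst.{u} t _) (𝟙 _) ≫
          qInterval.{u} ◁ (ihom qInterval.{u}).map f := by
      rw [CartesianMonoidalCategory.lift_whiskerLeft, CartesianMonoidalCategory.comp_lift,
        Category.id_comp, Category.comp_id]
      rfl
    rw [reassoc_of% h, ihom.ev_naturality, Category.assoc, Functor.id_map]

instance : (Opens.grothendieckTopology B).HasSheafCompose (ihom qInterval.{u}) :=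
  have : PreservesLimitsOfSize.{u, u} (ihom qInterval.{u}) :=
    (ihom.adjunction qInterval.{u}).rightAdjoint_preservesLimits
  inferInstance

/-- The sheaf of paths `U ↦ G(U)^[0,1]`. -/
def pathSheaf (G : ContSheaf B) : ContSheaf B :=
  (sheafCompose (Opens.grothendieckTopology B) (ihom qInterval.{u})).obj G

/-- Evaluation of paths at `t`. -/
def pathSheafEval (t : unitInterval) (G : ContSheaf B) : pathSheaf G ⟶ G :=
  ⟨Functor.whiskerLeft G.obj (evalPath t)⟩

/-- The mapping track of `f : F ⟶ G`: the sheaf `F ×_G G^[0,1]`, where `G^[0,1] ⟶ G` is the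
evaluation at `0`. -/
def mappingTrack {F G : ContSheaf B} (f : F ⟶ G) : ContSheaf B := pullback f (pathSheafEval 0 G)

/-- The morphism from the mapping track of `f : F ⟶ G` to `G` given by evaluation at `1`. -/
def mappingTrackMap {F G : ContSheaf B} (f : F ⟶ G) : mappingTrack f ⟶ G :=
  pullback.snd f (pathSheafEval 0 G) ≫ pathSheafEval 1 G

/-- The flexible track of `f : F ⟶ G`: the mapping track of `F^* ⟶ G^*`. -/
def flexibleTrack {F G : ContSheaf B} (f : F ⟶ G) :
    mappingTrack (formalSections.map f) ⟶ formalSections.obj G :=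
  mappingTrackMap (formalSections.map f)

end

/-! A section of `F^*` is locally a point of `F(U)^{Sing^q(U)}`: it depends on a parameter and,
separately, on an auxiliary point `p` of `U`. Hence its parameter can be changed differently at
different points of the base: a family `γ` over `S` and a continuous `θ : T × U → S` give the family
`(t, p) ↦ γ(θ(t, p), p)` over `T` (`formalSections.act`).

By `isFlexibleExtension_of_lift` the task is to extend a family `e` over a horn, defined on an open
`V`, to the simplex, keeping near `K` a given extension `a` that exists only on a smaller open `U ⊇
K`. Normality gives `χ : B → [0,1]` and an open `W` with `V ⊆ U ∪ W`, where `χ = 0` near `K` and `χ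
= 1` on `U ∩ W` (`exists_cutoff`). Let `H` deform the simplex, relative to the horn, from the
identity to a retraction onto the horn. Acting on `a` by `H(-, χ(p))` changes nothing near `K`, and
on `U ∩ W` it yields the pullback of `e` along the retraction, which makes sense on all of `W`. The
two glue (`formalSections.exists_extension`), and this already shows that `F^*` is flexible.

For the track of `f`, the image in `G^*` is prescribed over the whole simplex and must not be moved.
The path coordinate provides the room: a section of the track is a section of `F^*` over `S` and one
of `G^*` over `S × [0,1]`, matched at height `0`, while the prescribed image sits at height `1`. The
second component is known on the box formed by the cylinder on the horn and the top. A deformation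
of the cylinder into this box, fixing the box and restricting to `H` on the bottom
(`exists_boxRetraction`, `cylHomotopy_bottom`), is used with the same `χ`, so the two extended
components still match.

The rest translates the definitions into points: exponentials by currying, fibrations as lifting of
points over horns (`isQFibration_of_lift`), and `F(K)` as germs, because filtered colimits of
quasitopological spaces are computed objectwise. -/

noncomputable section

/-! ## Points of quasitopological spaces -/

namespace QTop

/-- The set `X[S]` of morphisms from `S` to the quasitopological space `X`. -/
abbrev Sec (X : QTop.{u}) (S : SingDelta) : Type u := X.obj.obj (op S)

/-- The composite of `x ∈ X[T]` with a continuous map `S → T`. -/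
def pull (X : QTop.{u}) {S T : SingDelta} (f : C(S, T)) (x : X.Sec T) : X.Sec S :=
  X.obj.map (SingDelta.ofMap f).op x

/-- The map `X[S] → Y[S]` induced by a morphism `X ⟶ Y`. -/
def ap {X Y : QTop.{u}} (g : X ⟶ Y) {S : SingDelta} (x : X.Sec S) : Y.Sec S :=
  g.hom.app (op S) x

variable {X Y Z : QTop.{u}} {R S T : SingDelta}

lemma pull_id (x : X.Sec S) : X.pull (ContinuousMap.id S) x = x :=
  X.obj.map_id_apply (op S) x

lemma pull_pull (f : C(R, S)) (g : C(S, T)) (x : X.Sec T) :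
    X.pull f (X.pull g x) = X.pull (g.comp f) x :=
  (X.obj.map_comp_apply (SingDelta.ofMap g).op (SingDelta.ofMap f).op x).symm

lemma ap_pull (g : X ⟶ Y) (f : C(S, T)) (x : X.Sec T) :
    ap g (X.pull f x) = Y.pull f (ap g x) :=
  NatTrans.naturality_apply g.hom (SingDelta.ofMap f).op x

lemma ap_comp (f : X ⟶ Y) (g : Y ⟶ Z) (x : X.Sec S) : ap (f ≫ g) x = ap g (ap f x) := rfl

lemma hom_ext_ap {f g : X ⟶ Y} (h : ∀ (S : SingDelta) (x : X.Sec S), ap f x = ap g x) :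
    f = g := by
  ext S x
  exact h S.unop x

/-- A morphism of quasitopological spaces from a natural family of maps. -/
def homMk (φ : ∀ S, X.Sec S → Y.Sec S)
    (h : ∀ (S T : SingDelta) (f : C(S, T)) (x : X.Sec T), φ S (X.pull f x) = Y.pull f (φ T x)) :
    X ⟶ Y :=
  ⟨{ app S := ↾(φ S.unop)
     naturality S T f := by
       ext x
       exact h T.unop S.unop f.unop x }⟩

/-! ### Gluing along finite closed coverings -/

lemma ext_cover (c : S.FiniteClosedCover) {x y : X.Sec S}
    (h : ∀ i, X.pull (SingDelta.toMap (c.ι i)) x = X.pull (SingDelta.toMap (c.ι i)) y) :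
    x = y := by
  have hs := (isSheaf_iff_forall_cover _).1 X.property S c
  rw [SingDelta.FiniteClosedCover.presieve, Presieve.isSheafFor_arrows_iff] at hs
  obtain ⟨t, _, ht⟩ := hs (fun i => X.obj.map (c.ι i).op x) (fun i j W gi gj hg => by
    rw [← X.obj.map_comp_apply, ← X.obj.map_comp_apply, ← op_comp, ← op_comp, hg])
  exact (ht x fun i => rfl).trans (ht y fun i => (h i).symm).symm

lemma exists_glue_cover (c : S.FiniteClosedCover) (x : ∀ i, X.Sec (c.piece i))
    (h : ∀ i j, X.pull (SingDelta.toMap (c.index.fst (i, j)).unop) (x i) =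
      X.pull (SingDelta.toMap (c.index.snd (i, j)).unop) (x j)) :
    ∃ t : X.Sec S, ∀ i, X.pull (SingDelta.toMap (c.ι i)) t = x i := by
  have hs := (isSheaf_iff_forall_cover _).1 X.property S c
  rw [SingDelta.FiniteClosedCover.presieve, Presieve.isSheafFor_arrows_iff] at hs
  obtain ⟨t, ht, _⟩ := hs x (fun i j W gi gj hg => by
    have hm : ∀ z : W, (SingDelta.toMap gi z).1 ∈ c.C i ∩ c.C j := fun z =>
      ⟨(SingDelta.toMap gi z).2, by
        have h1 : (SingDelta.toMap gi z).1 = (SingDelta.toMap gj z).1 :=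
          congrArg (fun q : S => q.1) (congrArg (fun f => SingDelta.toMap f z) hg)
        rw [h1]
        exact (SingDelta.toMap gj z).2⟩
    -- Maps to two pieces with the same composite to `S` factor through the intersection, so
    -- matching there is enough.
    let l : C(W, c.inter i j) := ⟨fun z => ⟨(SingDelta.toMap gi z).1, hm z⟩,
        (continuous_subtype_val.comp (SingDelta.toMap gi).continuous).subtype_mk _⟩
    have h2 : (SingDelta.toMap (c.index.snd (i, j)).unop).comp l = SingDelta.toMap gj :=
      ContinuousMap.ext fun z => Subtype.ext
        (congrArg (fun f : W ⟶ S => (SingDelta.toMap f z).1) hg)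
    exact (pull_pull l _ (x i)).symm.trans ((congrArg (X.pull l) (h i j)).trans
      ((pull_pull l _ (x j)).trans (congrArg (fun k => X.pull k (x j)) h2))))
  exact ⟨t, ht⟩

/-! ### Representable quasitopological spaces and exponentials -/

/-- The quasitopological space represented by `S`. -/
def repr (S : SingDelta) : QTop.{u} := singQ.obj (TopCat.of (ULift.{u} S))

/-- The point of the space represented by `S` given by a continuous map to `S`. -/
def reprPt (f : C(T, S)) : (repr.{u} S).Sec T :=
  (⟨fun t => ULift.up (f t), continuous_uliftUp.comp f.continuous⟩ : C(T, ULift S))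

/-- The continuous map to `S` underlying a point of the space represented by `S`. -/
def reprMap (y : (repr.{u} S).Sec T) : C(T, S) :=
  (⟨ULift.down, continuous_uliftDown⟩ : C(ULift S, S)).comp (show C(T, ULift S) from y)

lemma reprMap_pull (g : C(R, T)) (y : (repr.{u} S).Sec T) :
    reprMap ((repr S).pull g y) = (reprMap y).comp g := rfl

/-- The morphism from the space represented by `S` corresponding to a point of `X[S]`. -/
def reprHom (x : X.Sec S) : repr S ⟶ X :=
  homMk (fun _ y => X.pull (reprMap y) x)
    fun _ _ f y => by rw [reprMap_pull, pull_pull]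

lemma ap_reprHom (x : X.Sec S) (f : C(T, S)) :
    ap (reprHom x) (reprPt f) = X.pull f x := rfl

/-- The pair of two points, as a point of the product. -/
def pair (x : X.Sec S) (y : Y.Sec S) : (X ⊗ Y).Sec S := (x, y)

lemma exists_pair (z : (X ⊗ Y).Sec S) : ∃ (x : X.Sec S) (y : Y.Sec S), z = pair x y :=
  ⟨z.1, z.2, rfl⟩

/-- The value of a point of the exponential `X^A` at a point of `A`. -/
def ihomEv {A : QTop.{u}} (γ : ((ihom A).obj X).Sec S) (τ : A.Sec S) : X.Sec S :=
  ap ((ihom.ev A).app X) (pair τ γ)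

variable {A A' : QTop.{u}}

lemma pull_ihomEv (f : C(S, T)) (γ : ((ihom A).obj X).Sec T) (τ : A.Sec T) :
    X.pull f (ihomEv γ τ) = ihomEv (((ihom A).obj X).pull f γ) (A.pull f τ) := by
  exact (ap_pull ((ihom.ev A).app X) f (pair τ γ)).symm

lemma ihomEv_map (g : X ⟶ Y) (γ : ((ihom A).obj X).Sec S) (τ : A.Sec S) :
    ihomEv (ap ((ihom A).map g) γ) τ = ap g (ihomEv γ τ) := by
  have h := ihom.ev_naturality A g
  have h' := congrArg (fun k => ap k (pair τ γ)) h
  exact h'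

lemma ihomEv_pre (k : A' ⟶ A) (γ : ((ihom A).obj X).Sec S) (τ : A'.Sec S) :
    ihomEv (ap ((MonoidalClosed.pre k).app X) γ) τ = ihomEv γ (ap k τ) := by
  have h := MonoidalClosed.id_tensor_pre_app_comp_ev k X
  have h' := congrArg (fun k => ap k (pair τ γ)) h
  exact h'

/-- By Yoneda and currying, a point of `X^A` over `S` is a morphism `A ⊗ repr S ⟶ X`, hence is known
from its values after every base change `T → S`. -/
lemma ihom_ext {γ γ' : ((ihom A).obj X).Sec S}
    (h : ∀ (T : SingDelta) (f : C(T, S)) (τ : A.Sec T),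
      ihomEv (((ihom A).obj X).pull f γ) τ = ihomEv (((ihom A).obj X).pull f γ') τ) : γ = γ' := by
  have h1 : reprHom γ = reprHom γ' := by
    apply MonoidalClosed.uncurry_injective
    refine hom_ext_ap fun T z => ?_
    obtain ⟨τ, y, rfl⟩ := exists_pair z
    rw [MonoidalClosed.uncurry_eq, MonoidalClosed.uncurry_eq]
    exact h T (reprMap y) τ
  have h2 := congrArg (fun k => ap k (reprPt (ContinuousMap.id S))) h1
  simp only [ap_reprHom] at h2
  rwa [pull_id, pull_id] at h2

/-- The naturality of `ψ` makes it a morphism `A ⊗ repr S ⟶ X`; the point sought is its transpose at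
the identity of `S`. -/
lemma exists_ihom (ψ : ∀ T : SingDelta, C(T, S) → A.Sec T → X.Sec T)
    (h : ∀ (R T : SingDelta) (g : C(R, T)) (f : C(T, S)) (τ : A.Sec T),
      X.pull g (ψ T f τ) = ψ R (f.comp g) (A.pull g τ)) :
    ∃ γ : ((ihom A).obj X).Sec S, ∀ (T : SingDelta) (f : C(T, S)) (τ : A.Sec T),
      ihomEv (((ihom A).obj X).pull f γ) τ = ψ T f τ := by
  let k : A ⊗ repr S ⟶ X := homMk (fun T z => ψ T (reprMap z.2) z.1)
    fun R T g z => (h R T g (reprMap z.2) z.1).symm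
  refine ⟨ap (MonoidalClosed.curry k) (reprPt (ContinuousMap.id S)), fun T f τ => ?_⟩
  have h1 : ap (MonoidalClosed.uncurry (MonoidalClosed.curry k)) (pair τ (reprPt f)) =
      ψ T f τ := by
    rw [MonoidalClosed.uncurry_curry]
    rfl
  rw [MonoidalClosed.uncurry_eq] at h1
  rw [← ap_pull]
  exact h1

end QTop
end

noncomputable section

/-! ## Lifting against realizations of horns -/

open Simplicial SimplexCategory

/-- The affine map of simplices given by a morphism in the simplex category. -/
def simplexMap {m n : SimplexCategory} (α : m ⟶ n) :
    C(simplexInclusion.obj m, simplexInclusion.obj n) :=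
  SingDelta.toMap (simplexInclusion.map α)

lemma simplexMap_comp {l m n : SimplexCategory} (α : l ⟶ m) (β : m ⟶ n) :
    simplexMap (α ≫ β) = (simplexMap β).comp (simplexMap α) :=
  simplexInclusion.map_comp α β

/-- The `n`-simplex, as a topological space. -/
def simplexHomeo (n : ℕ) : simplexInclusion.obj ⦋n⦌ ≃ₜ stdSimplex ℝ (Fin (n + 1)) :=
  Homeomorph.Set.univ (stdSimplex ℝ (Fin (n + 1)))

lemma simplexHomeo_simplexMap {m n : ℕ} (α : ⦋m⦌ ⟶ ⦋n⦌) (x : simplexInclusion.obj ⦋m⦌)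
    (j : Fin (n + 1)) : simplexHomeo n (simplexMap α x) j =
      ∑ a : Fin (m + 1) with α.toOrderHom a = j, simplexHomeo m x a :=
  FunOnFinite.linearMap_apply_apply ℝ ℝ _ _ _

lemma simplexMap_apply_of_injective {m n : ℕ} (α : ⦋m⦌ ⟶ ⦋n⦌)
    (hα : Function.Injective α.toOrderHom) (x : simplexInclusion.obj ⦋m⦌) (a : Fin (m + 1)) :
    simplexHomeo n (simplexMap α x) (α.toOrderHom a) = simplexHomeo m x a := by
  refine (simplexHomeo_simplexMap α x _).trans (Finset.sum_eq_single_of_mem a (by simp) ?_)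
  intro b hb hba
  exact absurd (hα (Finset.mem_filter.1 hb).2) hba

lemma simplexMap_injective {m n : ℕ} (α : ⦋m⦌ ⟶ ⦋n⦌) (hα : Function.Injective α.toOrderHom) :
    Function.Injective (simplexMap α) := by
  intro x y h
  apply (simplexHomeo m).injective
  ext a
  rw [← simplexMap_apply_of_injective α hα x, ← simplexMap_apply_of_injective α hα y, h]

lemma simplexMap_apply_of_notMem {m n : ℕ} (α : ⦋m⦌ ⟶ ⦋n⦌) (x : simplexInclusion.obj ⦋m⦌)
    {j : Fin (n + 1)} (hj : ∀ a : Fin (m + 1), α.toOrderHom a ≠ j) :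
    simplexHomeo n (simplexMap α x) j = 0 :=
  (simplexHomeo_simplexMap α x j).trans
    (Finset.sum_eq_zero fun a ha => absurd (Finset.mem_filter.1 ha).2 (hj a))

/-- A map to a simplex with values in a face factors through the inclusion of the face. -/
lemma exists_simplexMap_comp_eq {W : SingDelta} {m n : ℕ} (α : ⦋m⦌ ⟶ ⦋n⦌)
    (hα : Function.Injective α.toOrderHom) (g : C(W, simplexInclusion.obj ⦋n⦌))
    (hg : ∀ w j, (∀ a : Fin (m + 1), α.toOrderHom a ≠ j) → simplexHomeo n (g w) j = 0) :
    ∃ r : C(W, simplexInclusion.obj ⦋m⦌), (simplexMap α).comp r = g := by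
  let f : Fin (m + 1) → Fin (n + 1) := α.toOrderHom
  have key (w : W) : (fun a => simplexHomeo n (g w) (f a)) ∈ stdSimplex ℝ (Fin (m + 1)) := by
    refine ⟨fun a => stdSimplex.zero_le _ _, ?_⟩
    rw [← Finset.sum_image (s := Finset.univ) (g := f) (f := fun j => simplexHomeo n (g w) j)
      (fun a _ b _ h => hα h), ← stdSimplex.sum_eq_one (simplexHomeo n (g w))]
    refine Finset.sum_subset (Finset.subset_univ _) fun j _ hj => hg w j fun a ha => hj ?_
    exact Finset.mem_image.2 ⟨a, Finset.mem_univ _, ha⟩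
  have hc : Continuous fun w => (⟨_, key w⟩ : stdSimplex ℝ (Fin (m + 1))) :=
    Continuous.subtype_mk (continuous_pi fun a => (continuous_apply (f a)).comp
      (continuous_subtype_val.comp ((simplexHomeo n).continuous.comp g.continuous))) _
  refine ⟨⟨fun w => (simplexHomeo m).symm ⟨_, key w⟩,
    (simplexHomeo m).symm.continuous.comp hc⟩, ?_⟩
  refine ContinuousMap.ext fun w => (simplexHomeo n).injective ?_
  ext j
  by_cases hj : ∃ a : Fin (m + 1), α.toOrderHom a = j
  · obtain ⟨a, rfl⟩ := hj
    exact (simplexMap_apply_of_injective α hα _ a)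
  · rw [hg w j fun a ha => hj ⟨a, ha⟩]
    exact simplexMap_apply_of_notMem α _ fun a ha => hj ⟨a, ha⟩

/-- Two distinct facets of a simplex meet in a simplex of codimension two; the compatibility of horn
data is tested on it. -/
lemma exists_simplex_avoiding {m : ℕ} {j k : Fin (m + 3)} (hjk : j ≠ k) :
    ∃ α : ⦋m⦌ ⟶ ⦋m + 2⦌, Function.Injective α.toOrderHom ∧
      ∀ l : Fin (m + 3), (∃ a : Fin (m + 1), α.toOrderHom a = l) ↔ l ≠ j ∧ l ≠ k := by
  have hc : ({j, k}ᶜ : Finset (Fin (m + 3))).card = m + 1 := by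
    rw [Finset.card_compl, Finset.card_pair hjk, Fintype.card_fin]
    rfl
  let e := ({j, k}ᶜ : Finset (Fin (m + 3))).orderEmbOfFin hc
  refine ⟨SimplexCategory.mkHom e.toOrderHom, e.injective, fun l => ?_⟩
  refine (Set.ext_iff.1 (Finset.range_orderEmbOfFin _ hc) l).trans ?_
  simp [and_comm]

/-- The face of the simplex opposite to a vertex. -/
def oppositeFace {n : ℕ} (j : Fin (n + 1)) : Set (stdSimplex ℝ (Fin (n + 1))) :=
  Set.ofPred fun x => x j = 0

lemma isClosed_oppositeFace {n : ℕ} (j : Fin (n + 1)) : IsClosed (oppositeFace j) :=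
  isClosed_eq ((continuous_apply j).comp continuous_subtype_val) continuous_const

/-- The union of the faces of a simplex containing the vertex `i`. -/
def hornObj (n : ℕ) (i : Fin (n + 2)) : SingDelta where
  dim := n + 1
  carrier := ⋃ a : Fin (n + 1), oppositeFace (i.succAbove a)
  isClosed := isClosed_iUnion_of_finite fun a => isClosed_oppositeFace (i.succAbove a)

/-- The inclusion of a horn into the simplex. -/
def hornIncl (n : ℕ) (i : Fin (n + 2)) : C(hornObj n i, simplexInclusion.obj ⦋n + 1⦌) :=
  ⟨Set.inclusion (show (hornObj n i).carrier ⊆ Set.univ from Set.subset_univ _),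
    continuous_inclusion _⟩

lemma hornIncl_injective (n : ℕ) (i : Fin (n + 2)) : Function.Injective (hornIncl n i) :=
  fun _ _ h => Subtype.ext (congrArg (fun z : simplexInclusion.obj ⦋n + 1⦌ => z.1) h)

/-- A map to the simplex with values in the horn factors through the horn. -/
lemma exists_hornIncl_comp_eq {W : SingDelta} {n : ℕ} {i : Fin (n + 2)}
    (g : C(W, simplexInclusion.obj ⦋n + 1⦌))
    (hg : ∀ w, ∃ a : Fin (n + 1), simplexHomeo (n + 1) (g w) (i.succAbove a) = 0) :
    ∃ r : C(W, hornObj n i), (hornIncl n i).comp r = g :=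
  ⟨⟨fun w => ⟨(g w).1, Set.mem_iUnion.2 (hg w)⟩,
    (continuous_subtype_val.comp g.continuous).subtype_mk _⟩, rfl⟩

/-- The covering of the horn by its faces. -/
def hornCover (n : ℕ) (i : Fin (n + 2)) : (hornObj n i).FiniteClosedCover where
  k := n + 1
  C a := oppositeFace (i.succAbove a)
  isClosed a := isClosed_oppositeFace (i.succAbove a)
  iUnion_eq := rfl

/-- The simplicial set of singular simplices of a quasitopological space. -/
def singularSet : QTop.{u} ⥤ SSet.{u} :=
  sheafToPresheaf _ _ ⋙
    Presheaf.restrictedULiftYoneda.{u} (simplexInclusion ⋙ uliftYoneda.{u})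

/-- Realization is left adjoint to the singular simplicial set. -/
def realizationAdjunction : realization.{u} ⊣ singularSet.{u} :=
  (Presheaf.uliftYonedaAdjunction.{u}
    (uliftYoneda.{u}.leftKanExtension (simplexInclusion ⋙ uliftYoneda.{u}))
    (uliftYoneda.{u}.leftKanExtensionUnit _)).comp (sheafificationAdjunction _ _)

/-! ### Horns in singular simplicial sets and points over topological horns -/

namespace QTop

variable {X Y : QTop.{u}} {n m : SimplexCategory}

/-- Singular simplices of `X` are the points of `X` over the simplex. -/
def singularEquiv : (SSet.stdSimplex.{u}.obj n ⟶ singularSet.obj X) ≃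
    X.Sec (simplexInclusion.obj n) :=
  SSet.yonedaEquiv.trans (Equiv.ulift.trans uliftYonedaEquiv)

lemma singularEquiv_map (β : m ⟶ n) (k : SSet.stdSimplex.{u}.obj n ⟶ singularSet.obj X) :
    singularEquiv (SSet.stdSimplex.map β ≫ k) = X.pull (simplexMap β) (singularEquiv k) := by
  have h1 := SSet.yonedaEquiv_naturality β k
  have h2 := uliftYonedaEquiv_naturality (SSet.yonedaEquiv k).down (simplexInclusion.map β).op
  refine Eq.trans ?_ h2.symm
  exact congrArg (fun t => uliftYonedaEquiv (ULift.down t)) h1.symm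

lemma singularEquiv_comp (p : X ⟶ Y) (k : SSet.stdSimplex.{u}.obj n ⟶ singularSet.obj X) :
    singularEquiv (k ≫ singularSet.map p) = ap p (singularEquiv k) :=
  uliftYonedaEquiv_comp (SSet.yonedaEquiv k).down p.hom

/-- A map from the simplicial horn is a compatible family of singular simplices on its faces. These
faces form a finite closed covering of the topological horn, so the sheaf condition assembles them
into one point. -/
lemma exists_horn_glue {n : ℕ} {i : Fin (n + 2)}
    (f : (SSet.horn.{u} (n + 1) i : SSet) ⟶ singularSet.obj X) :
    ∃ x : X.Sec (hornObj n i), ∀ (a : Fin (n + 1)) (W : SingDelta)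
      (g : C(W, hornObj n i)) (r : C(W, simplexInclusion.obj ⦋n⦌)),
      (simplexMap (δ (i.succAbove a))).comp r = (hornIncl n i).comp g →
      X.pull g x =
        X.pull r (singularEquiv (SSet.horn.ι i (i.succAbove a) (Fin.succAbove_ne i a) ≫ f)) := by
  have hδ (j : Fin (n + 2)) : Function.Injective (δ j : ⦋n⦌ ⟶ ⦋n + 1⦌).toOrderHom :=
    Fin.succAbove_right_injective
  have hr (a : Fin (n + 1)) := exists_simplexMap_comp_eq (W := (hornCover n i).piece a)
    (δ (i.succAbove a)) (hδ _)
    ((hornIncl n i).comp (SingDelta.toMap ((hornCover n i).ι a))) (fun w j hj => by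
      have : j = i.succAbove a := by
        by_contra h
        obtain ⟨b, hb⟩ := Fin.exists_succAbove_eq h
        exact hj b hb
      rw [this]
      exact w.2)
  choose r hr using hr
  obtain ⟨x, hx⟩ := exists_glue_cover (hornCover n i) (fun a => X.pull (r a)
    (singularEquiv (SSet.horn.ι i (i.succAbove a) (Fin.succAbove_ne i a) ≫ f))) (by
    intro (a : Fin (n + 1)) (b : Fin (n + 1))
    by_cases hab : a = b
    · subst hab
      rfl
    -- A horn in the 1-simplex has a single face, so distinct faces occur only for `n = m + 1`; they
    -- then meet in an `m`-simplex.
    obtain _ | m := n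
    · exact absurd (Subsingleton.elim (α := Fin 1) a b) hab
    have hne : i.succAbove a ≠ i.succAbove b := fun h => hab (Fin.succAbove_right_injective h)
    obtain ⟨α, hα, hαr⟩ := exists_simplex_avoiding hne
    obtain ⟨β, hβ⟩ := eq_comp_δ_of_not_surjective' α (i.succAbove a)
      (fun c hc => ((hαr _).1 ⟨c, hc⟩).1 rfl)
    obtain ⟨β', hβ'⟩ := eq_comp_δ_of_not_surjective' α (i.succAbove b)
      (fun c hc => ((hαr _).1 ⟨c, hc⟩).2 rfl)
    let g : C((hornCover (m + 1) i).inter a b, simplexInclusion.obj ⦋m + 2⦌) :=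
      ⟨Set.inclusion (Set.subset_univ _), continuous_inclusion _⟩
    obtain ⟨q, hq⟩ := exists_simplexMap_comp_eq α hα g (fun w j hj => by
      have hj' : j = i.succAbove a ∨ j = i.succAbove b := by
        by_contra h
        obtain ⟨c, hc⟩ := (hαr j).2 (not_or.1 h)
        exact hj c hc
      obtain rfl | rfl := hj'
      · exact w.2.1
      · exact w.2.2)
    have h1 : (r a).comp (SingDelta.toMap ((hornCover (m + 1) i).index.fst (a, b)).unop) =
        (simplexMap β).comp q := by
      refine ContinuousMap.ext fun w => simplexMap_injective _ (hδ (i.succAbove a)) ?_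
      have h3 := hq
      rw [hβ, simplexMap_comp] at h3
      exact (DFunLike.congr_fun (hr a) _).trans (DFunLike.congr_fun h3 w).symm
    have h2 : (r b).comp (SingDelta.toMap ((hornCover (m + 1) i).index.snd (a, b)).unop) =
        (simplexMap β').comp q := by
      refine ContinuousMap.ext fun w => simplexMap_injective _ (hδ (i.succAbove b)) ?_
      have h3 := hq
      rw [hβ', simplexMap_comp] at h3
      exact (DFunLike.congr_fun (hr b) _).trans (DFunLike.congr_fun h3 w).symm
    -- After composition with the monomorphism from the horn to the simplex, both sides become the
    -- inclusion `α` of the common face.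
    have h3 : SSet.stdSimplex.map β ≫ SSet.horn.ι.{u} i (i.succAbove a) (Fin.succAbove_ne i a) =
        SSet.stdSimplex.map β' ≫ SSet.horn.ι i (i.succAbove b) (Fin.succAbove_ne i b) := by
      rw [← cancel_mono (SSet.horn (m + 2) i).ι, Category.assoc, Category.assoc, SSet.horn.ι_ι,
        SSet.horn.ι_ι]
      refine (SSet.stdSimplex.map_comp β (δ (i.succAbove a))).symm.trans
        (Eq.trans ?_ (SSet.stdSimplex.map_comp β' (δ (i.succAbove b))))
      rw [← hβ, ← hβ']
    have h4 : X.pull (simplexMap β) (singularEquiv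
          (SSet.horn.ι i (i.succAbove a) (Fin.succAbove_ne i a) ≫ f)) =
        X.pull (simplexMap β') (singularEquiv
          (SSet.horn.ι i (i.succAbove b) (Fin.succAbove_ne i b) ≫ f)) := by
      rw [← singularEquiv_map, ← singularEquiv_map, ← Category.assoc, ← Category.assoc, h3]
    have h5 := congrArg (X.pull q) h4
    rw [pull_pull, pull_pull] at h5
    refine (pull_pull _ _ _).trans (Eq.trans ?_ (pull_pull _ _ _).symm)
    exact (congrArg (fun l => X.pull l _) h1).trans
      (h5.trans (congrArg (fun l => X.pull l _) h2).symm))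
  refine ⟨x, fun a W g s hs => ?_⟩
  have hmem (w : W) : (g w).1 ∈ (hornCover n i).C a := by
    have h1 : hornIncl n i (g w) = simplexMap (δ (i.succAbove a)) (s w) :=
      (DFunLike.congr_fun hs w).symm
    change simplexHomeo (n + 1) (hornIncl n i (g w)) (i.succAbove a) = 0
    rw [h1]
    exact simplexMap_apply_of_notMem _ _ fun b => Fin.succAbove_ne _ b
  let l : C(W, (hornCover n i).piece a) :=
    ⟨fun w => ⟨(g w).1, hmem w⟩, (continuous_subtype_val.comp g.continuous).subtype_mk _⟩
  have hl : (r a).comp l = s := by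
    refine ContinuousMap.ext fun w => simplexMap_injective _ (hδ (i.succAbove a)) ?_
    exact (DFunLike.congr_fun (hr a) (l w)).trans (DFunLike.congr_fun hs w).symm
  have hx' := congrArg (X.pull l) (hx a)
  refine Eq.trans ?_ (hx'.trans ?_)
  · exact (pull_pull l (SingDelta.toMap ((hornCover n i).ι a)) x).symm
  · exact (pull_pull _ _ _).trans (congrArg (fun l => X.pull l _) hl)

lemma horn_ext {n : ℕ} {i : Fin (n + 2)} {x y : X.Sec (hornObj n i)}
    (h : ∀ (a : Fin (n + 1)) (s : C(simplexInclusion.obj ⦋n⦌, hornObj n i)),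
      (hornIncl n i).comp s = simplexMap (δ (i.succAbove a)) → X.pull s x = X.pull s y) :
    x = y := by
  refine ext_cover (hornCover n i) fun a => ?_
  have hδ : Function.Injective (δ (i.succAbove a) : ⦋n⦌ ⟶ ⦋n + 1⦌).toOrderHom :=
    Fin.succAbove_right_injective
  obtain ⟨r, hr⟩ := exists_simplexMap_comp_eq (W := (hornCover n i).piece a)
    (δ (i.succAbove a)) hδ
    ((hornIncl n i).comp (SingDelta.toMap ((hornCover n i).ι a))) (fun w j hj => by
      have : j = i.succAbove a := by
        by_contra h
        obtain ⟨b, hb⟩ := Fin.exists_succAbove_eq h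
        exact hj b hb
      rw [this]
      exact w.2)
  obtain ⟨s, hs⟩ := exists_hornIncl_comp_eq (i := i) (simplexMap (δ (i.succAbove a)))
    fun w => ⟨a, simplexMap_apply_of_notMem _ _ fun b => Fin.succAbove_ne _ b⟩
  have h1 : SingDelta.toMap ((hornCover n i).ι a) = s.comp r := by
    refine ContinuousMap.ext fun w => hornIncl_injective n i ?_
    exact (DFunLike.congr_fun hr w).symm.trans (DFunLike.congr_fun hs (r w)).symm
  rw [h1, ← pull_pull, ← pull_pull, h a s hs]

/-- A morphism is a fibration if points over a horn lift to points over the simplex. -/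
lemma isQFibration_of_lift {P Q : QTop.{u}} (p : P ⟶ Q)
    (h : ∀ (n : ℕ) (i : Fin (n + 2)) (x : P.Sec (hornObj n i))
      (y : Q.Sec (simplexInclusion.obj ⦋n + 1⦌)), ap p x = Q.pull (hornIncl n i) y →
      ∃ z, P.pull (hornIncl n i) z = x ∧ ap p z = y) : IsQFibration p := by
  rw [IsQFibration, generatingAcyclicCofibrations]
  intro A B j hj
  obtain ⟨n, hj⟩ := (MorphismProperty.iSup_iff _ _).1 hj
  rcases hj with ⟨i⟩
  -- Transposing to simplicial sets avoids describing the realization of the horn.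
  rw [realizationAdjunction.hasLiftingProperty_iff]
  refine ⟨fun {f g} sq => ?_⟩
  obtain ⟨x, hx⟩ := exists_horn_glue f
  have hxs {a : Fin (n + 1)} {s : C(simplexInclusion.obj ⦋n⦌, hornObj n i)}
      (hs : (hornIncl n i).comp s = simplexMap (δ (i.succAbove a))) :
      P.pull s x = singularEquiv (SSet.horn.ι i (i.succAbove a) (Fin.succAbove_ne i a) ≫ f) := by
    rw [hx a _ s (ContinuousMap.id _) hs.symm, pull_id]
  have hxy : ap p x = Q.pull (hornIncl n i) (singularEquiv g) := by
    refine horn_ext fun a s hs => ?_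
    rw [← ap_pull, hxs hs, pull_pull, hs, ← singularEquiv_comp, Category.assoc, sq.w,
      SSet.horn.ι_ι_assoc]
    exact singularEquiv_map _ _
  obtain ⟨z, hz1, hz2⟩ := h n i x (singularEquiv g) hxy
  refine ⟨⟨singularEquiv.symm z, ?_, ?_⟩⟩
  · refine SSet.horn.hom_ext _ _ fun j hj => ?_
    obtain ⟨a, rfl⟩ := Fin.exists_succAbove_eq hj
    rw [← SSet.horn.yonedaEquiv_ι, ← SSet.yonedaEquiv_comp, ← SSet.yonedaEquiv_comp]
    congr 1
    apply singularEquiv.injective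
    rw [SSet.horn.ι_ι_assoc]
    refine (singularEquiv_map _ _).trans ?_
    obtain ⟨s, hs⟩ := exists_hornIncl_comp_eq (i := i) (simplexMap (δ (i.succAbove a)))
      fun w => ⟨a, simplexMap_apply_of_notMem _ _ fun b => Fin.succAbove_ne _ b⟩
    rw [Equiv.apply_symm_apply, ← hs, ← pull_pull, hz1, hxs hs]
  · apply singularEquiv.injective
    rw [singularEquiv_comp, Equiv.apply_symm_apply, hz2]

end QTop
end

noncomputable section

/-! ## Filtered colimits of quasitopological spaces -/

namespace QTop

variable {J : Type u} [SmallCategory J] [IsFiltered J]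

/-- The sheaf condition for a finite closed covering is a finite limit, built from the members and
their pairwise intersections, and filtered colimits of sets commute with finite limits. The
objectwise colimit is therefore already a sheaf. -/
lemma isSheaf_colimit (D : J ⥤ QTop.{u}) :
    Presheaf.IsSheaf SingDelta.topology ((D ⋙ sheafToPresheaf _ _).flip ⋙ colim) := by
  rw [isSheaf_iff_forall_cover]
  intro S c
  rw [c.isSheafFor_iff]
  have h : IsLimit ((D ⋙ sheafToPresheaf _ _).flip.mapCone c.fork) :=
    evaluationJointlyReflectsLimits _ fun j =>
      ((c.isSheafFor_iff _).1 ((isSheaf_iff_forall_cover _).1 (D.obj j).property S c)).some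
  exact ⟨isLimitOfPreserves colim h⟩

instance preservesColimit_sheafToPresheaf (D : J ⥤ QTop.{u}) :
    PreservesColimit D (sheafToPresheaf SingDelta.topology (Type u)) := by
  let E := D ⋙ sheafToPresheaf _ _
  let c' : Cocone E :=
    { pt := E.flip ⋙ colim
      ι := { app j := { app S := colimit.ι (E.flip.obj S) j }
             naturality i j f := by
               ext1
               funext S
               exact (colimit.w (E.flip.obj S) f).trans (Category.comp_id _).symm } }
  have hc' : IsColimit c' := evaluationJointlyReflectsColimits _ fun S =>
    colimit.isColimit (E.flip.obj S)
  let c : Cocone D :=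
    { pt := ⟨E.flip ⋙ colim, isSheaf_colimit D⟩
      ι := { app j := ⟨c'.ι.app j⟩
             naturality i j f := by
               ext1
               exact c'.ι.naturality f } }
  have hc : IsColimit ((sheafToPresheaf _ _).mapCocone c) := hc'
  exact preservesColimit_of_preserves_colimit_cocone
    (isColimitOfReflects (sheafToPresheaf _ _) hc) hc

variable (D : J ⥤ QTop.{u}) {S : SingDelta}

/-- The colimit cocone of the points over `S`. -/
def isColimitSec (S : SingDelta) :
    IsColimit ((sheafToPresheaf SingDelta.topology (Type u) ⋙
      (evaluation _ _).obj (op S)).mapCocone (colimit.cocone D)) :=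
  isColimitOfPreserves _ (colimit.isColimit D)

lemma exists_ap_colimitι (x : (colimit D).Sec S) :
    ∃ (j : J) (y : (D.obj j).Sec S), ap (colimit.ι D j) y = x :=
  Types.jointly_surjective _ (isColimitSec D S) x

lemma ap_colimitι_eq_iff {i j : J} {x : (D.obj i).Sec S} {y : (D.obj j).Sec S} :
    ap (colimit.ι D i) x = ap (colimit.ι D j) y ↔
      ∃ (k : J) (f : i ⟶ k) (g : j ⟶ k), ap (D.map f) x = ap (D.map g) y :=
  Types.FilteredColimit.isColimit_eq_iff _ (isColimitSec D S)

end QTop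

/-! ## Germs of sections of continuous sheaves along compact sets -/

namespace ContSheaf

open QTop

variable {B : TopCat.{u}} {F G : ContSheaf B} {U V W : Opens B} {S T : SingDelta}

/-- The set `F(U)[S]`. -/
abbrev Sec (F : ContSheaf B) (U : Opens B) (S : SingDelta) : Type u := (F.obj.obj (op U)).Sec S

/-- The restriction `F(V)[S] → F(U)[S]`. -/
def res (F : ContSheaf B) (h : U ≤ V) (x : F.Sec V S) : F.Sec U S :=
  ap (F.obj.map (homOfLE h).op) x

/-- The map `F(V)[T] → F(V)[S]` induced by a continuous map `S → T`. -/
abbrev pb (F : ContSheaf B) (f : C(S, T)) (x : F.Sec V T) : F.Sec V S :=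
  (F.obj.obj (op V)).pull f x

/-- The map `F(U)[S] → G(U)[S]` induced by a morphism of sheaves. -/
def sap (f : F ⟶ G) (x : F.Sec U S) : G.Sec U S := ap (f.hom.app (op U)) x

lemma res_self (x : F.Sec V S) : F.res le_rfl x = x :=
  congrArg (fun k => ap k x) (F.obj.map_id (op V))

lemma res_res (h : U ≤ V) (h' : V ≤ W) (x : F.Sec W S) :
    F.res h (F.res h' x) = F.res (h.trans h') x :=
  (congrArg (fun k => ap k x) (F.obj.map_comp (homOfLE h').op (homOfLE h).op)).symm

lemma res_pb (h : U ≤ V) (f : C(S, T)) (x : F.Sec V T) :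
    F.res h (F.pb f x) = F.pb f (F.res h x) := ap_pull _ _ _

lemma sap_pb (g : F ⟶ G) (f : C(S, T)) (x : F.Sec V T) :
    sap g (F.pb f x) = G.pb f (sap g x) := ap_pull _ _ _

lemma sap_res (g : F ⟶ G) (h : U ≤ V) (x : F.Sec V S) :
    sap g (F.res h x) = G.res h (sap g x) :=
  congrArg (fun k => ap k x) (g.hom.naturality (homOfLE h).op)

variable {K L : Set B}

/-- The germ along `K` of a section over a neighbourhood of `K`. -/
def germ (F : ContSheaf B) (h : K ⊆ U) (x : F.Sec U S) : (sectionsOn F K).Sec S :=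
  ap (colimit.ι (nbhdDiagram F K) (op ⟨U, h⟩)) x

instance : IsFiltered (OpenNbhds K)ᵒᵖ :=
  have : Nonempty (OpenNbhds K) := ⟨⟨⊤, fun _ _ => trivial⟩⟩
  have : IsCodirectedOrder (OpenNbhds K) :=
    ⟨fun U V => ⟨⟨U.1 ⊓ V.1, fun _ hx => ⟨U.2 hx, V.2 hx⟩⟩, inf_le_left (a := U.1),
      inf_le_right (a := U.1)⟩⟩
  inferInstance

lemma exists_germ (x : (sectionsOn F K).Sec S) :
    ∃ (U : Opens B) (h : K ⊆ U) (y : F.Sec U S), F.germ h y = x := by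
  obtain ⟨j, y, hy⟩ := exists_ap_colimitι (nbhdDiagram F K) x
  exact ⟨j.unop.1, j.unop.2, y, hy⟩

lemma germ_eq_iff (hU : K ⊆ U) (hV : K ⊆ V) {x : F.Sec U S} {y : F.Sec V S} :
    F.germ hU x = F.germ hV y ↔
      ∃ (W : Opens B) (_ : K ⊆ W) (h : W ≤ U) (h' : W ≤ V), F.res h x = F.res h' y := by
  refine (ap_colimitι_eq_iff (nbhdDiagram F K)).trans ⟨?_, ?_⟩
  · rintro ⟨k, f, g, h⟩
    exact ⟨k.unop.1, k.unop.2, leOfHom f.unop, leOfHom g.unop, h⟩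
  · rintro ⟨W, hW, h, h', e⟩
    exact ⟨op ⟨W, hW⟩, (homOfLE (show (⟨W, hW⟩ : OpenNbhds K) ≤ ⟨U, hU⟩ from h)).op,
      (homOfLE (show (⟨W, hW⟩ : OpenNbhds K) ≤ ⟨V, hV⟩ from h')).op, e⟩

lemma germ_res (hU : K ⊆ U) (hV : K ⊆ V) (h : U ≤ V) (x : F.Sec V S) :
    F.germ hU (F.res h x) = F.germ hV x :=
  (germ_eq_iff hU hV).2 ⟨U, hU, le_rfl, h, res_self _⟩

lemma germ_pull (hU : K ⊆ U) (f : C(S, T)) (x : F.Sec U T) :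
    F.germ hU (F.pb f x) = (sectionsOn F K).pull f (F.germ hU x) := ap_pull _ _ _

lemma ap_sectionsOnMap_germ (f : F ⟶ G) (hU : K ⊆ U) (x : F.Sec U S) :
    ap (sectionsOnMap f K) (F.germ hU x) = G.germ hU (sap f x) :=
  congrArg (fun k => ap k x) (ι_colimMap (Functor.whiskerLeft
    (Subtype.mono_coe fun U : Opens B => K ⊆ U).functor.op f.hom) (op ⟨U, hU⟩))

lemma ap_restriction_germ (h : K ⊆ L) (hU : L ⊆ U) (x : F.Sec U S) :
    ap (restriction F h) (F.germ hU x) = F.germ (h.trans hU) x :=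
  congrArg (fun k => ap k x) (colimit.ι_pre (nbhdDiagram F K) (nbhdsOfSubset h).op (op ⟨U, hU⟩))

/-- A morphism of sheaves is a flexible extension if sections over neighbourhoods lift. -/
lemma isFlexibleExtension_of_lift [T2Space B] (f : F ⟶ G)
    (h : ∀ (n : ℕ) (i : Fin (n + 2)) (K : Set B) (U V : Opens B), IsClosed K → K ⊆ U →
      ∀ (hUV : U ≤ V) (e : F.Sec V (hornObj n i)) (b : G.Sec V (simplexInclusion.obj (.mk (n + 1))))
      (a : F.Sec U (simplexInclusion.obj (.mk (n + 1)))),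
      sap f e = G.pb (hornIncl n i) b → sap f a = G.res hUV b →
      F.pb (hornIncl n i) a = F.res hUV e →
      ∃ (z : F.Sec V (simplexInclusion.obj (.mk (n + 1)))) (W : Opens B) (_ : K ⊆ W) (hWU : W ≤ U),
        F.res (hWU.trans hUV) z = F.res hWU a ∧ F.pb (hornIncl n i) z = e ∧ sap f z = b) :
    IsFlexibleExtension f := by
  intro K L hK hL hKL
  apply isQFibration_of_lift
  intro n i x y hxy
  -- Taking points over the simplex preserves the fibre product, so the lift can be checked on its
  -- two components.
  have hpb := (IsPullback.of_hasPullback (sectionsOnMap f K) (restriction G hKL)).map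
    (sheafToPresheaf SingDelta.topology (Type u) ⋙
      (evaluation _ _).obj (op (simplexInclusion.obj (.mk (n + 1)))))
  obtain ⟨V₁, hV₁, e, rfl⟩ := exists_germ x
  obtain ⟨U₁, hU₁, a, ha⟩ := exists_germ
    (ap (pullback.fst (sectionsOnMap f K) (restriction G hKL)) y)
  obtain ⟨V₂, hV₂, b, hb⟩ := exists_germ
    (ap (pullback.snd (sectionsOnMap f K) (restriction G hKL)) y)
  have hy : ap (sectionsOnMap f K) (ap (pullback.fst _ (restriction G hKL)) y) =
      ap (restriction G hKL) (ap (pullback.snd (sectionsOnMap f K) _) y) :=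
    congrArg (fun k => ap k y) (pullback.condition (f := sectionsOnMap f K)
      (g := restriction G hKL))
  have h1 := congrArg (ap (pullback.fst (sectionsOnMap f K) (restriction G hKL))) hxy
  have h2 := congrArg (ap (pullback.snd (sectionsOnMap f K) (restriction G hKL))) hxy
  rw [ap_pull, ← ap_comp, relativeRestriction, pullback.lift_fst, ← ha, ap_restriction_germ,
    ← germ_pull, germ_eq_iff] at h1
  rw [ap_pull, ← ap_comp, relativeRestriction, pullback.lift_snd, ← hb, ap_sectionsOnMap_germ,
    ← germ_pull, germ_eq_iff] at h2
  rw [← ha, ← hb, ap_sectionsOnMap_germ, ap_restriction_germ, germ_eq_iff] at hy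
  obtain ⟨U₂, hU₂, k₁, k₂, h1⟩ := h1
  obtain ⟨V, hV, k₃, k₄, h2⟩ := h2
  obtain ⟨U₃, hU₃, k₅, k₆, hy⟩ := hy
  -- Each equality of germs holds on an actual neighbourhood: `e` against `b` on `V ⊇ L`, and `a`
  -- against `e` and against `b` on `U₂` and `U₃`, which contain `K`.
  let U := U₂ ⊓ U₃ ⊓ V
  have hU : K ⊆ U := fun z hz => ⟨⟨hU₂ hz, hU₃ hz⟩, hV (hKL hz)⟩
  have l₂ : U ≤ U₂ := inf_le_left.trans inf_le_left
  have l₃ : U ≤ U₃ := inf_le_left.trans inf_le_right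
  have lV : U ≤ V := inf_le_right
  obtain ⟨z, W, hW, hWU, hz1, hz2, hz3⟩ := h n i K U V hK.isClosed hU lV (F.res k₃ e) (G.res k₄ b)
    (F.res (l₃.trans k₅) a) (by rw [sap_res, h2, res_pb])
    (by rw [sap_res, res_res, ← res_res l₃ k₅, hy, res_res])
    (by rw [← res_pb, res_res, ← res_res l₂ k₁, h1, res_res])
  refine ⟨F.germ hV z, ?_, ?_⟩
  · rw [← germ_pull, hz2, germ_res]
  · refine Types.ext_of_isPullback hpb ?_ ?_
    · change ap _ (ap _ _) = ap _ _
      rw [← ap_comp, relativeRestriction, pullback.lift_fst, ← ha, ap_restriction_germ,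
        germ_eq_iff]
      exact ⟨W, hW, hWU.trans lV, hWU.trans (l₃.trans k₅), by rw [hz1, res_res]⟩
    · change ap _ (ap _ _) = ap _ _
      rw [← ap_comp, relativeRestriction, pullback.lift_snd, ← hb, ap_sectionsOnMap_germ, hz3,
        germ_res]

end ContSheaf
end

noncomputable section

/-! ## Gluing sections of continuous sheaves -/

namespace ContSheaf

open QTop

variable {B : TopCat.{u}} {F G : ContSheaf B} {U V W : Opens B} {R S T : SingDelta}

/-- The sheaf of sets `U ↦ F(U)[S]`. -/
def slice (F : ContSheaf B) (S : SingDelta) : TopCat.Sheaf (Type u) B :=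
  ⟨(ContPresheaf.slices F.obj).obj (op S), ContPresheaf.isSheaf_slices F (op S)⟩

lemma ext_of_locally {x y : F.Sec V S}
    (h : ∀ p ∈ V, ∃ (W : Opens B) (hW : W ≤ V), p ∈ W ∧ F.res hW x = F.res hW y) : x = y := by
  choose W hW hp e using h
  refine (F.slice S).eq_of_locally_eq' (fun p : V => W p.1 p.2) V (fun p => homOfLE (hW p.1 p.2))
    (fun p hp' => Opens.mem_iSup.2 ⟨⟨p, hp'⟩, hp p hp'⟩) x y fun p => e p.1 p.2

lemma exists_glue {ι : Type u} (W : ι → Opens B) (hW : ∀ i, W i ≤ V)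
    (hV : ∀ p ∈ V, ∃ i, p ∈ W i) (s : ∀ i, F.Sec (W i) S)
    (h : ∀ i j, F.res inf_le_left (s i) = F.res (inf_le_right (a := W i) (b := W j)) (s j)) :
    ∃ t : F.Sec V S, ∀ i, F.res (hW i) t = s i := by
  let s' : ∀ i, ToType ((F.slice S).1.obj (op (W i))) := fun i => s i
  have hs' : TopCat.Presheaf.IsCompatible (F.slice S).1 W s' := h
  exact ((F.slice S).existsUnique_gluing' W V (fun i => homOfLE (hW i))
    (fun p hp => Opens.mem_iSup.2 (hV p hp)) s' hs').exists

lemma exists_glue₂ (hU : U ≤ V) (hW : W ≤ V) (hV : V ≤ U ⊔ W) (x : F.Sec U S) (y : F.Sec W S)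
    (h : F.res inf_le_left x = F.res (inf_le_right (a := U) (b := W)) y) :
    ∃ t : F.Sec V S, F.res hU t = x ∧ F.res hW t = y := by
  -- `exists_glue` takes its index in `Type u`, hence the lifted `Bool`, with `true` for `U` and
  -- `false` for `W`.
  let A (b : ULift.{u} Bool) : Opens B := Bool.rec W U b.down
  let s (b : ULift.{u} Bool) : F.Sec (A b) S :=
    Bool.rec (motive := fun b => F.Sec (Bool.rec W U b : Opens B) S) y x b.down
  obtain ⟨t, ht⟩ := exists_glue (F := F) (S := S) A (V := V)
    (by rintro ⟨_ | _⟩; exacts [hW, hU])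
    (fun p hp => by
      obtain h | h := hV hp
      exacts [⟨⟨true⟩, h⟩, ⟨⟨false⟩, h⟩]) s
    (by
      rintro ⟨_ | _⟩ ⟨_ | _⟩
      · rfl
      · have h' := congrArg (F.res (show W ⊓ U ≤ U ⊓ W from inf_comm W U |>.le)) h
        rw [res_res, res_res] at h'
        exact h'.symm
      · exact h
      · rfl)
  exact ⟨t, ht ⟨true⟩, ht ⟨false⟩⟩

lemma ext_of_cover₂ (hU : U ≤ V) (hW : W ≤ V) (hV : V ≤ U ⊔ W) {x y : F.Sec V S}
    (h₁ : F.res hU x = F.res hU y) (h₂ : F.res hW x = F.res hW y) : x = y :=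
  ext_of_locally fun _ hp => (hV hp).elim (fun h => ⟨U, hU, h, h₁⟩) fun h => ⟨W, hW, h, h₂⟩

end ContSheaf

/-! ## Sheafification of continuous presheaves -/

namespace ContPresheaf

open QTop

variable {B : TopCat.{u}} {U V : Opens B} {S : SingDelta}

/-- The set `P(U)[S]`. -/
abbrev Sec (P : ContPresheaf B) (U : Opens B) (S : SingDelta) : Type u := (P.obj (op U)).Sec S

/-- The restriction `P(V)[S] → P(U)[S]`. -/
def res (P : ContPresheaf B) (h : U ≤ V) (x : P.Sec V S) : P.Sec U S :=
  ap (P.map (homOfLE h).op) x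

/-- The sheafification of a continuous presheaf. -/
abbrev sh (P : ContPresheaf B) : ContSheaf B :=
  (presheafToSheaf (Opens.grothendieckTopology B) QTop.{u}).obj P

/-- The map from the sections of a continuous presheaf to those of its sheafification. -/
def toSh (P : ContPresheaf B) (x : P.Sec U S) : P.sh.Sec U S :=
  ap ((toSheafify (Opens.grothendieckTopology B) P).app (op U)) x

variable (P : ContPresheaf B)

lemma res_toSh (h : U ≤ V) (x : P.Sec V S) : P.sh.res h (P.toSh x) = P.toSh (P.res h x) :=
  (congrArg (fun k => ap k x)
    ((toSheafify (Opens.grothendieckTopology B) P).naturality (homOfLE h).op)).symm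

/-- The comparison of the abstract sheafification with the objectwise one. -/
def shIso : sheafify (Opens.grothendieckTopology B) P ≅ P.sheafified where
  hom := sheafifyLift _ P.toSheafified P.isSheaf_sheafified
  inv := P.sheafifiedLift P.sh (toSheafify _ P)
  hom_inv_id := by
    apply sheafify_hom_ext _ _ _ P.sh.property
    rw [← Category.assoc, toSheafify_sheafifyLift, toSheafified_lift, Category.comp_id]
  inv_hom_id := by
    apply P.sheafified_hom_ext ⟨P.sheafified, P.isSheaf_sheafified⟩
    rw [← Category.assoc, toSheafified_lift, toSheafify_sheafifyLift, Category.comp_id]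

lemma toSheafify_shIso_hom :
    toSheafify _ P ≫ P.shIso.hom = P.toSheafified :=
  toSheafify_sheafifyLift _ _ _

/-- The objectwise description `shIso` reduces local injectivity here, and local surjectivity in
`exists_locally_toSh_eq`, to sheafification of presheaves of sets, one `S` at a time. -/
lemma exists_locally_eq_of_toSh_eq {x y : P.Sec U S} (h : P.toSh x = P.toSh y) {p : B}
    (hp : p ∈ U) : ∃ (V : Opens B) (hV : V ≤ U), p ∈ V ∧ P.res hV x = P.res hV y := by
  have h1 : ap (P.toSheafified.app (op U)) x = ap (P.toSheafified.app (op U)) y := by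
    rw [← toSheafify_shIso_hom]
    exact congrArg (ap (P.shIso.hom.app (op U))) h
  have h2 := Presheaf.equalizerSieve_mem (Opens.grothendieckTopology B)
    (toSheafify (Opens.grothendieckTopology B) (P.slices.obj (op S))) (X := op U) x y h1
  obtain ⟨V, f, hf, hV⟩ := h2 p hp
  exact ⟨V, leOfHom f, hV, hf⟩

lemma exists_locally_toSh_eq (z : P.sh.Sec U S) {p : B} (hp : p ∈ U) :
    ∃ (V : Opens B) (hV : V ≤ U), p ∈ V ∧ ∃ x : P.Sec V S, P.toSh x = P.sh.res hV z := by
  have h2 := Presheaf.imageSieve_mem (Opens.grothendieckTopology B)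
    (toSheafify (Opens.grothendieckTopology B) (P.slices.obj (op S))) (U := op U)
    (ap (P.shIso.hom.app (op U)) z)
  obtain ⟨V, f, ⟨x, hx⟩, hV⟩ := h2 p hp
  refine ⟨V, leOfHom f, hV, x, ?_⟩
  have h3 : ap (P.toSheafified.app (op V)) x =
      ap (P.sheafified.map f.op) (ap (P.shIso.hom.app (op U)) z) := hx
  have h4 := congrArg (fun k => ap k z) (P.shIso.hom.naturality f.op)
  rw [← toSheafify_shIso_hom] at h3
  have h5 := congrArg (ap (P.shIso.inv.app (op V))) (h3.trans h4.symm)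
  have h6 (w : P.sh.Sec V S) :
      ap (P.shIso.inv.app (op V)) (ap (P.shIso.hom.app (op V)) w) = w :=
    congrArg (fun k => ap k w) (P.shIso.hom_inv_id_app (op V))
  exact (h6 _).symm.trans (h5.trans (h6 _))

end ContPresheaf
end

noncomputable section

/-! ## Families of maps parametrized by the base acting on formal sections -/

open QTop ContSheaf

variable {B : TopCat.{u}} {F G : ContSheaf B} {U V W : Opens B} {Q R S T : SingDelta}

/-- The restriction to `U` of a family of maps parametrized by `V`. -/
def resFam (h : U ≤ V) (θ : C(T × V, S)) : C(T × U, S) :=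
  θ.comp ((ContinuousMap.id T).prodMap ⟨Set.inclusion h, continuous_inclusion h⟩)

/-- The quasitopological space of an open subset of the base. -/
abbrev openQ (V : Opens B) : QTop.{u} := singQ.obj ((Opens.toTopCat B).obj V)

/-- The map underlying a point of the quasitopological space of an open subset. -/
def openPt (τ : (openQ V).Sec S) : C(S, V) := τ

/-- The inclusion of open subsets, on points. -/
def openIncl (h : U ≤ V) (τ : (openQ U).Sec S) : (openQ V).Sec S :=
  ap (singQ.map ((Opens.toTopCat B).map (homOfLE h))) τ

namespace formalPresheaf

/-- The value of a point of `F(V)^{Sing^q(V)}`. -/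
def ev (γ : (formalPresheaf.obj F).Sec V S) (f : C(T, S)) (τ : (openQ V).Sec T) : F.Sec V T :=
  ihomEv (((formalPresheaf.obj F).obj (op V)).pull f γ) τ

lemma ext {γ γ' : (formalPresheaf.obj F).Sec V S}
    (h : ∀ (T : SingDelta) (f : C(T, S)) (τ : (openQ V).Sec T), ev γ f τ = ev γ' f τ) : γ = γ' :=
  ihom_ext h

lemma ev_pull (γ : (formalPresheaf.obj F).Sec V S) (g : C(R, S)) (f : C(T, R))
    (τ : (openQ V).Sec T) :
    ev (((formalPresheaf.obj F).obj (op V)).pull g γ) f τ = ev γ (g.comp f) τ := by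
  rw [ev, pull_pull, ev]

lemma pb_ev (γ : (formalPresheaf.obj F).Sec V S) (g : C(R, T)) (f : C(T, S))
    (τ : (openQ V).Sec T) :
    F.pb g (ev γ f τ) = ev γ (f.comp g) ((openQ V).pull g τ) := by
  refine (pull_ihomEv _ _ _).trans ?_
  exact congrArg (fun t => ihomEv t ((openQ V).pull g τ))
    (pull_pull (X := (formalPresheaf.obj F).obj (op V)) g f γ)

lemma ev_res (h : U ≤ V) (γ : (formalPresheaf.obj F).Sec V S) (f : C(T, S))
    (τ : (openQ U).Sec T) :
    ev ((formalPresheaf.obj F).res h γ) f τ = F.res h (ev γ f (openIncl h τ)) := by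
  have h1 : ((formalPresheaf.obj F).obj (op U)).pull f ((formalPresheaf.obj F).res h γ) =
      (formalPresheaf.obj F).res h (((formalPresheaf.obj F).obj (op V)).pull f γ) :=
    (ap_pull _ _ _).symm
  rw [ev, h1]
  refine (ihomEv_pre (X := F.obj.obj (op U)) (singQ.map ((Opens.toTopCat B).map (homOfLE h)))
    (ap ((ihom (openQ V)).map (F.obj.map (homOfLE h).op)) _) τ).trans ?_
  exact ihomEv_map _ _ _

lemma ev_map (g : F ⟶ G) (γ : (formalPresheaf.obj F).Sec V S) (f : C(T, S))
    (τ : (openQ V).Sec T) :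
    ev (ap ((formalPresheaf.map g).app (op V)) γ) f τ = sap g (ev γ f τ) := by
  have h1 : ((formalPresheaf.obj G).obj (op V)).pull f
      (ap ((formalPresheaf.map g).app (op V)) γ) =
      ap ((formalPresheaf.map g).app (op V)) (((formalPresheaf.obj F).obj (op V)).pull f γ) :=
    (ap_pull _ _ _).symm
  rw [ev, h1]
  exact ihomEv_map _ _ _

/-- This is where the exponential by `Sing^q(V)` matters: a point of it is evaluated at a parameter
`f` and a moving base point `τ`, so `τ` can also be fed into `θ`. -/
lemma exists_act (θ : C(T × V, S)) (γ : (formalPresheaf.obj F).Sec V S) :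
    ∃ γ' : (formalPresheaf.obj F).Sec V T,
      ∀ (R : SingDelta) (f : C(R, T)) (τ : (openQ V).Sec R), ev γ' f τ =
        ev γ (θ.comp (f.prodMk (openPt τ))) τ :=
  exists_ihom (fun _ f τ => ev γ (θ.comp (f.prodMk (openPt τ))) τ)
    fun _ _ g _ τ => pb_ev γ g _ τ

/-- The action of a family of maps on the points of `F(V)^{Sing^q(V)}`. -/
def act (θ : C(T × V, S)) (γ : (formalPresheaf.obj F).Sec V S) :
    (formalPresheaf.obj F).Sec V T :=
  (exists_act θ γ).choose

lemma ev_act (θ : C(T × V, S)) (γ : (formalPresheaf.obj F).Sec V S) (f : C(R, T))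
    (τ : (openQ V).Sec R) : ev (act θ γ) f τ = ev γ (θ.comp (f.prodMk (openPt τ))) τ :=
  (exists_act θ γ).choose_spec R f τ

lemma res_act (h : U ≤ V) (θ : C(T × V, S)) (γ : (formalPresheaf.obj F).Sec V S) :
    (formalPresheaf.obj F).res h (act θ γ) = act (resFam h θ) ((formalPresheaf.obj F).res h γ) :=
  ext fun R f τ => by
    rw [ev_res, ev_act, ev_act, ev_res]
    rfl

lemma act_fst (g : C(T, S)) (γ : (formalPresheaf.obj F).Sec V S) :
    act (g.comp ContinuousMap.fst) γ = ((formalPresheaf.obj F).obj (op V)).pull g γ :=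
  ext fun R f τ => by
    rw [ev_act, ev_pull]
    rfl

lemma pull_act (g : C(R, T)) (θ : C(T × V, S)) (γ : (formalPresheaf.obj F).Sec V S) :
    ((formalPresheaf.obj F).obj (op V)).pull g (act θ γ) =
      act (θ.comp (g.prodMap (ContinuousMap.id V))) γ :=
  ext fun R f τ => by
    rw [ev_pull, ev_act, ev_act]
    rfl

lemma act_pull (θ : C(T × V, R)) (g : C(R, S)) (γ : (formalPresheaf.obj F).Sec V S) :
    act θ (((formalPresheaf.obj F).obj (op V)).pull g γ) = act (g.comp θ) γ :=
  ext fun R f τ => by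
    rw [ev_act, ev_act, ev_pull]
    rfl

lemma map_act (g : F ⟶ G) (θ : C(T × V, S)) (γ : (formalPresheaf.obj F).Sec V S) :
    ap ((formalPresheaf.map g).app (op V)) (act θ γ) =
      act θ (ap ((formalPresheaf.map g).app (op V)) γ) :=
  ext fun R f τ => by
    rw [ev_map, ev_act, ev_act, ev_map]

end formalPresheaf

/-! ### Descent of the action to the sheaf of formal sections -/

namespace formalSections

/-- The formal section given by a point of `F(U)^{Sing^q(U)}`. -/
def mk (γ : (formalPresheaf.obj F).Sec U S) : (formalSections.obj F).Sec U S :=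
  (formalPresheaf.obj F).toSh γ

lemma res_mk (h : U ≤ V) (γ : (formalPresheaf.obj F).Sec V S) :
    (formalSections.obj F).res h (mk γ) = mk ((formalPresheaf.obj F).res h γ) :=
  ContPresheaf.res_toSh _ h γ

lemma pb_mk (g : C(T, S)) (γ : (formalPresheaf.obj F).Sec V S) :
    (formalSections.obj F).pb g (mk γ) =
      mk (((formalPresheaf.obj F).obj (op V)).pull g γ) :=
  (ap_pull _ _ _).symm

lemma sap_mk (f : F ⟶ G) (γ : (formalPresheaf.obj F).Sec V S) :
    sap (formalSections.map f) (mk γ) = mk (ap ((formalPresheaf.map f).app (op V)) γ) :=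
  congrArg (fun k : formalPresheaf.obj F ⟶ (formalSections.obj G).obj => ap (k.app (op V)) γ)
    (toSheafify_naturality (Opens.grothendieckTopology B) (formalPresheaf.map f)).symm

lemma exists_mk (z : (formalSections.obj F).Sec U S) {p : B} (hp : p ∈ U) :
    ∃ (V : Opens B) (hV : V ≤ U), p ∈ V ∧
      ∃ γ : (formalPresheaf.obj F).Sec V S, mk γ = (formalSections.obj F).res hV z :=
  ContPresheaf.exists_locally_toSh_eq _ z hp

/-- Independence of the representative: two representatives of `z` agree locally, and the action on
representatives commutes with restriction. -/
lemma res_mk_act_eq (θ : C(T × V, S)) (z : (formalSections.obj F).Sec V S) {W' : Opens B}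
    (hW : W ≤ V) (hW' : W' ≤ V) (γ : (formalPresheaf.obj F).Sec W S)
    (γ' : (formalPresheaf.obj F).Sec W' S) (h : mk γ = (formalSections.obj F).res hW z)
    (h' : mk γ' = (formalSections.obj F).res hW' z) (hU : U ≤ W) (hU' : U ≤ W') :
    (formalSections.obj F).res hU (mk (formalPresheaf.act (resFam hW θ) γ)) =
      (formalSections.obj F).res hU' (mk (formalPresheaf.act (resFam hW' θ) γ')) := by
  refine ext_of_locally fun p hp => ?_
  have h1 : mk ((formalPresheaf.obj F).res hU γ) = mk ((formalPresheaf.obj F).res hU' γ') := by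
    rw [← res_mk, ← res_mk, h, h', res_res, res_res]
  obtain ⟨A, hA, hpA, hγ⟩ := ContPresheaf.exists_locally_eq_of_toSh_eq _ h1 hp
  refine ⟨A, hA, hpA, ?_⟩
  rw [res_mk, res_mk, res_mk, res_mk, formalPresheaf.res_act, formalPresheaf.res_act,
    formalPresheaf.res_act, formalPresheaf.res_act, hγ]
  rfl

/-- The results on local representatives glue. Allowing every representative over every `W` in the
conclusion lets later identities be checked on whichever representative is at hand. -/
lemma exists_act (θ : C(T × V, S)) (z : (formalSections.obj F).Sec V S) :
    ∃ z' : (formalSections.obj F).Sec V T, ∀ (W : Opens B) (hW : W ≤ V)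
      (γ : (formalPresheaf.obj F).Sec W S), mk γ = (formalSections.obj F).res hW z →
        (formalSections.obj F).res hW z' = mk (formalPresheaf.act (resFam hW θ) γ) := by
  choose W hW hp γ hγ using fun p : V => exists_mk z p.2
  obtain ⟨z', hz'⟩ := exists_glue W hW (fun p hpV => ⟨⟨p, hpV⟩, hp _⟩)
    (fun p => mk (formalPresheaf.act (resFam (hW p) θ) (γ p)))
    fun p q => res_mk_act_eq θ z _ _ _ _ (hγ p) (hγ q) _ _
  refine ⟨z', fun A hA δ hδ => ext_of_locally fun p hpA => ?_⟩
  refine ⟨A ⊓ W ⟨p, hA hpA⟩, inf_le_left, ⟨hpA, hp _⟩, ?_⟩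
  rw [res_res, ← res_res inf_le_right (hW ⟨p, hA hpA⟩), hz']
  exact (res_mk_act_eq θ z _ _ _ _ hδ (hγ _) _ _).symm

/-- The action of a family of maps on formal sections. -/
def act (θ : C(T × V, S)) (z : (formalSections.obj F).Sec V S) :
    (formalSections.obj F).Sec V T :=
  (exists_act θ z).choose

lemma res_act_eq_mk (θ : C(T × V, S)) (z : (formalSections.obj F).Sec V S) (hW : W ≤ V)
    {γ : (formalPresheaf.obj F).Sec W S} (h : mk γ = (formalSections.obj F).res hW z) :
    (formalSections.obj F).res hW (act θ z) = mk (formalPresheaf.act (resFam hW θ) γ) :=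
  (exists_act θ z).choose_spec W hW γ h

lemma res_act (h : U ≤ V) (θ : C(T × V, S)) (z : (formalSections.obj F).Sec V S) :
    (formalSections.obj F).res h (act θ z) = act (resFam h θ) ((formalSections.obj F).res h z) := by
  refine ext_of_locally fun p hp => ?_
  obtain ⟨W, hW, hpW, γ, hγ⟩ := exists_mk z (h hp)
  refine ⟨U ⊓ W, inf_le_left, ⟨hp, hpW⟩, ?_⟩
  have hγ' : mk ((formalPresheaf.obj F).res (inf_le_right (a := U)) γ) =
      (formalSections.obj F).res (inf_le_right.trans hW) z := by
    rw [← res_mk, hγ, res_res]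
  rw [res_res, res_act_eq_mk θ z _ hγ', res_act_eq_mk (W := U ⊓ W) (resFam h θ) _ inf_le_left
    (hγ'.trans (res_res _ _ z).symm)]
  rfl

lemma act_fst (g : C(T, S)) (z : (formalSections.obj F).Sec V S) :
    act (g.comp ContinuousMap.fst) z = (formalSections.obj F).pb g z := by
  refine ext_of_locally fun p hp => ?_
  obtain ⟨W, hW, hpW, γ, hγ⟩ := exists_mk z hp
  refine ⟨W, hW, hpW, ?_⟩
  rw [res_act_eq_mk _ z _ hγ, res_pb, ← hγ, pb_mk, ← formalPresheaf.act_fst]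
  rfl

lemma pb_act (g : C(R, T)) (θ : C(T × V, S)) (z : (formalSections.obj F).Sec V S) :
    (formalSections.obj F).pb g (act θ z) = act (θ.comp (g.prodMap (ContinuousMap.id V))) z := by
  refine ext_of_locally fun p hp => ?_
  obtain ⟨W, hW, hpW, γ, hγ⟩ := exists_mk z hp
  refine ⟨W, hW, hpW, ?_⟩
  rw [res_act_eq_mk _ z _ hγ, res_pb, res_act_eq_mk _ z _ hγ, pb_mk, formalPresheaf.pull_act]
  rfl

lemma act_pb (θ : C(T × V, R)) (g : C(R, S)) (z : (formalSections.obj F).Sec V S) :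
    act θ ((formalSections.obj F).pb g z) = act (g.comp θ) z := by
  refine ext_of_locally fun p hp => ?_
  obtain ⟨W, hW, hpW, γ, hγ⟩ := exists_mk z hp
  refine ⟨W, hW, hpW, ?_⟩
  have hγ' : mk (((formalPresheaf.obj F).obj (op W)).pull g γ) =
      (formalSections.obj F).res hW ((formalSections.obj F).pb g z) := by
    rw [← pb_mk, hγ, res_pb]
  rw [res_act_eq_mk _ z _ hγ, res_act_eq_mk _ _ _ hγ', formalPresheaf.act_pull]
  rfl

lemma sap_act (f : F ⟶ G) (θ : C(T × V, S)) (z : (formalSections.obj F).Sec V S) :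
    sap (formalSections.map f) (act θ z) = act θ (sap (formalSections.map f) z) := by
  refine ext_of_locally fun p hp => ?_
  obtain ⟨W, hW, hpW, γ, hγ⟩ := exists_mk z hp
  refine ⟨W, hW, hpW, ?_⟩
  have hγ' : mk (ap ((formalPresheaf.map f).app (op W)) γ) =
      (formalSections.obj G).res hW (sap (formalSections.map f) z) := by
    rw [← sap_mk, hγ, sap_res]
  rw [← sap_res, res_act_eq_mk _ z _ hγ, res_act_eq_mk _ _ _ hγ', sap_mk, formalPresheaf.map_act]

end formalSections
end

noncomputable section

/-! ## Cylinders -/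

namespace SingDelta

instance (S : SingDelta) : CompactSpace S :=
  isCompact_iff_compactSpace.1 S.isClosed.isCompact

/-- The coordinates of the embedding of `S × [0,1]` into a simplex. -/
def cylCoord (S : SingDelta) (p : S × unitInterval) : Fin (S.dim + 2 + 1) → ℝ :=
  -- Halving makes the coordinates sum to one: the first two contribute `1/2` and record the height,
  -- the others contribute `1/2` and record the point of `S`.
  Fin.cons ((p.2 : ℝ) / 2) (Fin.cons ((1 - p.2 : ℝ) / 2) fun i => p.1.1 i / 2)

lemma cylCoord_mem (S : SingDelta) (p : S × unitInterval) :
    S.cylCoord p ∈ stdSimplex ℝ (Fin (S.dim + 2 + 1)) := by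
  have h0 := p.2.2.1
  have h1 := p.2.2.2
  constructor
  · refine Fin.cases ?_ (Fin.cases ?_ fun i => ?_)
    · simp only [cylCoord, Fin.cons_zero]
      linarith
    · simp only [cylCoord, Fin.cons_succ, Fin.cons_zero]
      linarith
    · simp only [cylCoord, Fin.cons_succ]
      exact div_nonneg (stdSimplex.zero_le _ _) zero_le_two
  · have h := stdSimplex.sum_eq_one p.1.1
    simp only [cylCoord, Fin.sum_univ_succ (n := S.dim + 2), Fin.sum_univ_succ (n := S.dim + 1),
      Fin.cons_zero, Fin.cons_succ, ← Finset.sum_div, h]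
    ring

/-- The embedding of `S × [0,1]` into a simplex. -/
def cylEmb (S : SingDelta) (p : S × unitInterval) : stdSimplex ℝ (Fin (S.dim + 2 + 1)) :=
  ⟨S.cylCoord p, S.cylCoord_mem p⟩

lemma continuous_cylEmb (S : SingDelta) : Continuous S.cylEmb := by
  refine Continuous.subtype_mk (continuous_pi (Fin.cases ?_ (Fin.cases ?_ fun i => ?_))) _
  · simp only [cylCoord, Fin.cons_zero]
    fun_prop
  · simp only [cylCoord, Fin.cons_succ, Fin.cons_zero]
    fun_prop
  · simp only [cylCoord, Fin.cons_succ]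
    exact ((continuous_apply i).comp (continuous_subtype_val.comp
      (continuous_subtype_val.comp continuous_fst))).div_const 2

lemma cylEmb_injective (S : SingDelta) : Function.Injective S.cylEmb := by
  intro p q h
  have h' : S.cylCoord p = S.cylCoord q := congrArg Subtype.val h
  refine Prod.ext (Subtype.ext (stdSimplex.ext (funext fun i => ?_))) (Subtype.ext ?_)
  · have := congrFun h' i.succ.succ
    simp only [cylCoord, Fin.cons_succ] at this
    linarith
  · have := congrFun h' 0
    simp only [cylCoord, Fin.cons_zero] at this
    linarith

/-- Compactness of `S × [0,1]` upgrades the continuous injection. Objects of the site are closed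
subsets of simplices, so a cylinder must be presented as such a subset. -/
lemma isClosedEmbedding_cylEmb (S : SingDelta) : Topology.IsClosedEmbedding S.cylEmb :=
  S.continuous_cylEmb.isClosedEmbedding S.cylEmb_injective

/-- The product of `S` with the unit interval. -/
def cyl (S : SingDelta) : SingDelta :=
  ⟨S.dim + 2, Set.range S.cylEmb, S.isClosedEmbedding_cylEmb.isClosed_range⟩

/-- The points of the cylinder on `S`. -/
def cylHomeo (S : SingDelta) : S × unitInterval ≃ₜ S.cyl :=
  S.isClosedEmbedding_cylEmb.toIsEmbedding.toHomeomorph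

variable {R S T : SingDelta}

/-- The map to a cylinder with the given components. -/
def cylMk (f : C(T, S)) (s : C(T, unitInterval)) : C(T, S.cyl) :=
  (⟨S.cylHomeo, S.cylHomeo.continuous⟩ : C(_, _)).comp (f.prodMk s)

/-- The projection of the cylinder to the base. -/
def cylBase (S : SingDelta) : C(S.cyl, S) :=
  ContinuousMap.fst.comp ⟨S.cylHomeo.symm, S.cylHomeo.symm.continuous⟩

/-- The height function on the cylinder. -/
def cylHeight (S : SingDelta) : C(S.cyl, unitInterval) :=
  ContinuousMap.snd.comp ⟨S.cylHomeo.symm, S.cylHomeo.symm.continuous⟩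

lemma cylBase_cylHomeo (p : S × unitInterval) : S.cylBase (S.cylHomeo p) = p.1 :=
  congrArg Prod.fst (S.cylHomeo.symm_apply_apply p)

lemma cylHeight_cylHomeo (p : S × unitInterval) : S.cylHeight (S.cylHomeo p) = p.2 :=
  congrArg Prod.snd (S.cylHomeo.symm_apply_apply p)

lemma cyl_ext {c d : S.cyl} (h₁ : S.cylBase c = S.cylBase d) (h₂ : S.cylHeight c = S.cylHeight d) :
    c = d :=
  S.cylHomeo.symm.injective (Prod.ext h₁ h₂)

lemma cylBase_cylMk_apply (f : C(T, S)) (s : C(T, unitInterval)) (x : T) :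
    S.cylBase (cylMk f s x) = f x :=
  cylBase_cylHomeo (f x, s x)

lemma cylHeight_cylMk_apply (f : C(T, S)) (s : C(T, unitInterval)) (x : T) :
    S.cylHeight (cylMk f s x) = s x :=
  cylHeight_cylHomeo (f x, s x)

lemma cylBase_cylMk (f : C(T, S)) (s : C(T, unitInterval)) : S.cylBase.comp (cylMk f s) = f := by
  ext1 x
  exact cylBase_cylMk_apply f s x

lemma cylHeight_cylMk (f : C(T, S)) (s : C(T, unitInterval)) :
    S.cylHeight.comp (cylMk f s) = s := by
  ext1 x
  exact cylHeight_cylMk_apply f s x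

lemma cylMk_cylBase_cylHeight : cylMk S.cylBase S.cylHeight = ContinuousMap.id S.cyl := by
  ext1 x
  exact S.cylHomeo.apply_symm_apply x

/-- The inclusion of the base at height `t`. -/
def cylAt (S : SingDelta) (t : unitInterval) : C(S, S.cyl) :=
  cylMk (ContinuousMap.id S) (ContinuousMap.const S t)

/-- The map of cylinders induced by a map of the bases. -/
def cylMap (g : C(R, S)) : C(R.cyl, S.cyl) := cylMk (g.comp R.cylBase) R.cylHeight

end SingDelta

/-! ## Paths -/

namespace QTop

open SingDelta

variable {X Y : QTop.{u}} {R S T : SingDelta}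

/-- The point of the interval given by a continuous function. -/
def intervalPt (s : C(S, unitInterval)) : qInterval.{u}.Sec S :=
  (⟨fun x => ULift.up (s x), continuous_uliftUp.comp s.continuous⟩ : C(S, ULift unitInterval))

lemma exists_intervalPt (τ : qInterval.{u}.Sec S) : ∃ s, intervalPt s = τ :=
  ⟨(⟨ULift.down, continuous_uliftDown⟩ : C(ULift unitInterval, unitInterval)).comp
    (show C(S, ULift unitInterval) from τ), rfl⟩

lemma pull_intervalPt (f : C(R, S)) (s : C(S, unitInterval)) :
    qInterval.{u}.pull f (intervalPt s) = intervalPt (s.comp f) := rfl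

/-- The point over the cylinder given by a path. -/
def toCyl (γ : ((ihom qInterval).obj X).Sec S) : X.Sec S.cyl :=
  ihomEv (((ihom qInterval).obj X).pull S.cylBase γ) (intervalPt S.cylHeight)

lemma pull_toCyl (γ : ((ihom qInterval).obj X).Sec S) (f : C(T, S)) (s : C(T, unitInterval)) :
    X.pull (cylMk f s) (toCyl γ) =
      ihomEv (((ihom qInterval).obj X).pull f γ) (intervalPt s) := by
  rw [toCyl, pull_ihomEv, pull_pull, pull_intervalPt, cylBase_cylMk, cylHeight_cylMk]

/-- The pair of `cylBase` and `cylHeight` is universal: any test map with a height is its pullback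
along `cylMk`. With `exists_toCyl_eq`, this identifies paths over `S` with points over the cylinder.
-/
lemma toCyl_injective {γ γ' : ((ihom qInterval).obj X).Sec S} (h : toCyl γ = toCyl γ') :
    γ = γ' :=
  ihom_ext fun T f τ => by
    obtain ⟨s, rfl⟩ := exists_intervalPt τ
    rw [← pull_toCyl, ← pull_toCyl, h]

lemma exists_toCyl_eq (x : X.Sec S.cyl) : ∃ γ : ((ihom qInterval).obj X).Sec S, toCyl γ = x := by
  obtain ⟨γ, hγ⟩ := exists_ihom (A := qInterval) (X := X) (S := S)
    (fun T f τ => X.pull (cylMk f ((⟨ULift.down, continuous_uliftDown⟩ :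
      C(ULift unitInterval, unitInterval)).comp (show C(T, ULift unitInterval) from τ))) x)
    (fun R T g f τ => by rw [pull_pull]; rfl)
  refine ⟨γ, (hγ _ _ _).trans ?_⟩
  refine Eq.trans ?_ (pull_id x)
  rw [← cylMk_cylBase_cylHeight]
  rfl

lemma toCyl_pull (g : C(R, S)) (γ : ((ihom qInterval).obj X).Sec S) :
    toCyl (((ihom qInterval).obj X).pull g γ) = X.pull (cylMap g) (toCyl γ) := by
  rw [cylMap, pull_toCyl, toCyl, pull_pull]

lemma toCyl_map (k : X ⟶ Y) (γ : ((ihom qInterval).obj X).Sec S) :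
    toCyl (ap ((ihom qInterval).map k) γ) = ap k (toCyl γ) := by
  rw [toCyl, ← ap_pull, ihomEv_map, toCyl]

lemma ap_evalPath (t : unitInterval) (γ : ((ihom qInterval).obj X).Sec S) :
    ap ((evalPath t).app X) γ = X.pull (S.cylAt t) (toCyl γ) := by
  rw [cylAt, pull_toCyl, pull_id]
  rfl

end QTop

/-! ## Points of mapping tracks -/

namespace ContSheaf

open QTop SingDelta

variable {B : TopCat.{u}} {F G : ContSheaf B} {U V : Opens B} {R S T : SingDelta}

/-- The section over the cylinder given by a section of the sheaf of paths. -/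
def pathCyl (γ : (pathSheaf G).Sec V S) : G.Sec V S.cyl := toCyl (X := G.obj.obj (op V)) γ

lemma res_pathCyl (h : U ≤ V) (γ : (pathSheaf G).Sec V S) :
    G.res h (pathCyl γ) = pathCyl ((pathSheaf G).res h γ) :=
  (toCyl_map (G.obj.map (homOfLE h).op) γ).symm

lemma pathCyl_pb (g : C(R, S)) (γ : (pathSheaf G).Sec V S) :
    pathCyl ((pathSheaf G).pb g γ) = G.pb (cylMap g) (pathCyl γ) :=
  toCyl_pull (X := G.obj.obj (op V)) g γ

lemma sap_pathSheafEval (t : unitInterval) (γ : (pathSheaf G).Sec V S) :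
    sap (pathSheafEval t G) γ = G.pb (S.cylAt t) (pathCyl γ) :=
  ap_evalPath t γ

variable {f : F ⟶ G}

/-- The projection of the mapping track to the source. -/
def trackFstHom (f : F ⟶ G) : mappingTrack f ⟶ F := pullback.fst f (pathSheafEval 0 G)

/-- The projection of the mapping track to the sheaf of paths. -/
def trackPathHom (f : F ⟶ G) : mappingTrack f ⟶ pathSheaf G := pullback.snd f (pathSheafEval 0 G)

lemma isPullback_track (f : F ⟶ G) :
    IsPullback (trackFstHom f) (trackPathHom f) f (pathSheafEval 0 G) :=
  IsPullback.of_hasPullback _ _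

/-- The component in `F` of a section of the mapping track. -/
def trackFst (z : (mappingTrack f).Sec V S) : F.Sec V S :=
  sap (trackFstHom f) z

/-- The path component of a section of the mapping track. -/
def trackPath (z : (mappingTrack f).Sec V S) : G.Sec V S.cyl :=
  pathCyl (sap (trackPathHom f) z)

lemma sap_trackFst (z : (mappingTrack f).Sec V S) :
    sap f (trackFst z) = G.pb (S.cylAt 0) (trackPath z) := by
  rw [trackPath, ← sap_pathSheafEval]
  exact congrArg (fun k => sap k z) (isPullback_track f).w

lemma sap_mappingTrackMap (z : (mappingTrack f).Sec V S) :
    sap (mappingTrackMap f) z = G.pb (S.cylAt 1) (trackPath z) :=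
  sap_pathSheafEval 1 (sap (trackPathHom f) z)

lemma res_trackFst (h : U ≤ V) (z : (mappingTrack f).Sec V S) :
    F.res h (trackFst z) = trackFst ((mappingTrack f).res h z) :=
  (sap_res (trackFstHom f) h z).symm

lemma res_trackPath (h : U ≤ V) (z : (mappingTrack f).Sec V S) :
    G.res h (trackPath z) = trackPath ((mappingTrack f).res h z) := by
  rw [trackPath, res_pathCyl, ← sap_res, trackPath]

lemma trackFst_pb (g : C(R, S)) (z : (mappingTrack f).Sec V S) :
    trackFst ((mappingTrack f).pb g z) = F.pb g (trackFst z) :=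
  sap_pb (trackFstHom f) g z

lemma trackPath_pb (g : C(R, S)) (z : (mappingTrack f).Sec V S) :
    trackPath ((mappingTrack f).pb g z) = G.pb (cylMap g) (trackPath z) := by
  rw [trackPath, sap_pb, pathCyl_pb, trackPath]

/-- The functor of sections over `V` and `S`. -/
def secFunctor (B : TopCat.{u}) (V : Opens B) (S : SingDelta) : ContSheaf B ⥤ Type u :=
  sheafToPresheaf _ _ ⋙ (evaluation _ _).obj (op V) ⋙ sheafToPresheaf _ _ ⋙
    (evaluation _ _).obj (op S)

/-- Forgetting to presheaves and evaluating both preserve limits; hence points of a mapping track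
are matching pairs, as in `track_ext` and `exists_track`. -/
instance (V : Opens B) (S : SingDelta) :
    PreservesLimit (cospan f (pathSheafEval 0 G)) (secFunctor B V S) := by
  unfold secFunctor
  infer_instance

lemma track_ext {z z' : (mappingTrack f).Sec V S} (h₁ : trackFst z = trackFst z')
    (h₂ : trackPath z = trackPath z') : z = z' :=
  Types.ext_of_isPullback
    ((isPullback_track f).map (secFunctor B V S)) h₁
    (toCyl_injective h₂)

lemma exists_track (x : F.Sec V S) (y : G.Sec V S.cyl) (h : sap f x = G.pb (S.cylAt 0) y) :
    ∃ z : (mappingTrack f).Sec V S, trackFst z = x ∧ trackPath z = y := by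
  obtain ⟨γ, rfl⟩ := exists_toCyl_eq y
  obtain ⟨z, h₁, h₂⟩ := Types.exists_of_isPullback
    ((isPullback_track f).map (secFunctor B V S)) x γ
    (h.trans (sap_pathSheafEval 0 γ).symm)
  exact ⟨z, h₁, congrArg pathCyl h₂⟩

end ContSheaf
end

noncomputable section

/-! ## Unions of closed subspaces -/

namespace SingDelta

variable {S T : SingDelta} {k : ℕ} {A : Fin k → SingDelta}

/-- The union of the images of a finite family of maps to `S`. -/
def unionRange (α : ∀ a, C(A a, S)) : SingDelta where
  dim := S.dim
  carrier := ⋃ a, Set.range fun x => (α a x).1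
  isClosed := isClosed_iUnion_of_finite fun a =>
    (isCompact_range (continuous_subtype_val.comp (α a).continuous)).isClosed

lemma unionRange_subset (α : ∀ a, C(A a, S)) : (unionRange α).carrier ⊆ S.carrier :=
  Set.iUnion_subset fun a => Set.range_subset_iff.2 fun x => (α a x).2

/-- The inclusion of the union of the images of a family of maps to `S`. -/
def unionIncl (α : ∀ a, C(A a, S)) : C(unionRange α, S) :=
  ⟨Set.inclusion (unionRange_subset α), continuous_inclusion _⟩

lemma unionIncl_injective (α : ∀ a, C(A a, S)) : Function.Injective (unionIncl α) :=
  fun _ _ h => Subtype.ext (congrArg (fun z : S => z.1) h)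

/-- A map with values in the union of the images factors through the union. -/
lemma exists_unionIncl_comp_eq (α : ∀ a, C(A a, S)) (g : C(T, S))
    (hg : ∀ t, ∃ a, ∃ x, α a x = g t) : ∃ r : C(T, unionRange α), (unionIncl α).comp r = g := by
  have hm (t : T) : (g t).1 ∈ (unionRange α).carrier := by
    obtain ⟨a, x, hx⟩ := hg t
    exact Set.mem_iUnion.2 ⟨a, x, congrArg Subtype.val hx⟩
  exact ⟨⟨fun t => ⟨(g t).1, hm t⟩,
    (continuous_subtype_val.comp g.continuous).subtype_mk _⟩, rfl⟩

/-- The covering of the union of the images. -/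
def unionCover (α : ∀ a, C(A a, S)) : (unionRange α).FiniteClosedCover where
  k := k
  C a := Set.range fun x => (α a x).1
  isClosed a := (isCompact_range (continuous_subtype_val.comp (α a).continuous)).isClosed
  iUnion_eq := rfl

/-- Since `A a` is compact, an injective `α a` is a homeomorphism onto its image, so data on `A a`
can be carried to the member of the covering. -/
lemma exists_inverse_on_piece (α : ∀ a, C(A a, S)) (hα : ∀ a, Function.Injective (α a))
    (a : Fin k) : ∃ r : C((unionCover α).piece a, A a), ∀ p, (α a (r p)).1 = p.1 := by
  let e := ((continuous_subtype_val.comp (α a).continuous).isClosedEmbedding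
    (Subtype.val_injective.comp (hα a))).toIsEmbedding.toHomeomorph
  exact ⟨⟨e.symm, e.symm.continuous⟩, fun p => congrArg Subtype.val (e.apply_symm_apply p)⟩

end SingDelta

namespace QTop

open SingDelta

variable {X : QTop.{u}} {S : SingDelta} {k : ℕ} {A : Fin k → SingDelta}

lemma exists_glue_union (α : ∀ a, C(A a, S)) (hα : ∀ a, Function.Injective (α a))
    (x : ∀ a, X.Sec (A a))
    (h : ∀ (a b : Fin k) (Z : SingDelta) (f : C(Z, A a)) (g : C(Z, A b)),
      (α a).comp f = (α b).comp g → X.pull f (x a) = X.pull g (x b)) :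
    ∃ t : X.Sec (unionRange α), ∀ (a : Fin k) (f : C(A a, unionRange α)),
      (unionIncl α).comp f = α a → X.pull f t = x a := by
  choose r hr using exists_inverse_on_piece α hα
  obtain ⟨t, ht⟩ := exists_glue_cover (unionCover α) (fun a => X.pull (r a) (x a)) (by
    intro a b
    refine (pull_pull _ _ _).trans (Eq.trans ?_ (pull_pull _ _ _).symm)
    refine h a b _ _ _ (ContinuousMap.ext fun p => Subtype.ext ?_)
    exact (hr a (SingDelta.toMap ((unionCover α).index.fst (a, b)).unop p)).trans
      (hr b (SingDelta.toMap ((unionCover α).index.snd (a, b)).unop p)).symm)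
  refine ⟨t, fun a f hf => ?_⟩
  have hm (y : A a) : (f y).1 ∈ (unionCover α).C a :=
    ⟨y, (congrArg Subtype.val (DFunLike.congr_fun hf y)).symm⟩
  let l : C(A a, (unionCover α).piece a) :=
    ⟨fun y => ⟨(f y).1, hm y⟩, (continuous_subtype_val.comp f.continuous).subtype_mk _⟩
  have hl : (r a).comp l = ContinuousMap.id _ := ContinuousMap.ext fun y => hα a
    (Subtype.ext ((hr a _).trans (congrArg Subtype.val (DFunLike.congr_fun hf y))))
  have h1 := (congrArg (X.pull l) (ht a)).trans (pull_pull l (r a) (x a))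
  rw [hl, pull_id] at h1
  exact (pull_pull l (SingDelta.toMap ((unionCover α).ι a)) t).symm.trans h1

lemma union_ext (α : ∀ a, C(A a, S)) (hα : ∀ a, Function.Injective (α a))
    {x y : X.Sec (unionRange α)} (h : ∀ (a : Fin k) (f : C(A a, unionRange α)),
      (unionIncl α).comp f = α a → X.pull f x = X.pull f y) : x = y := by
  refine ext_cover (unionCover α) fun a => ?_
  obtain ⟨r, hr⟩ := exists_inverse_on_piece α hα a
  obtain ⟨f, hf⟩ := exists_unionIncl_comp_eq α (α a) fun t => ⟨a, t, rfl⟩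
  have h1 : SingDelta.toMap ((unionCover α).ι a) = f.comp r :=
    ContinuousMap.ext fun p => unionIncl_injective α (Subtype.ext
      ((hr p).symm.trans (congrArg Subtype.val (DFunLike.congr_fun hf (r p)).symm)))
  rw [h1, ← pull_pull, ← pull_pull, h a f hf]

end QTop

/-! ### Unions of two closed subspaces -/

section Pair

open QTop SingDelta

/-- Injectivity settles the matching of each part with itself, so a single compatibility between `x`
and `y` remains. -/
lemma exists_union_of_fin_two {S : SingDelta} {A : Fin 2 → SingDelta} (δ : ∀ a, C(A a, S))
    (hδ : ∀ a, Function.Injective (δ a)) :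
    ∃ (M : SingDelta) (j : C(M, S)) (α : C(A 0, M)) (β : C(A 1, M)), Function.Injective j ∧
    j.comp α = δ 0 ∧ j.comp β = δ 1 ∧
    (∀ (T : SingDelta) (g : C(T, S)), (∀ t, (∃ x, δ 0 x = g t) ∨ ∃ x, δ 1 x = g t) →
      ∃ r : C(T, M), j.comp r = g) ∧
    ∀ X : QTop.{u},
      (∀ x y : X.Sec M, X.pull α x = X.pull α y → X.pull β x = X.pull β y → x = y) ∧
      ∀ (x : X.Sec (A 0)) (y : X.Sec (A 1)),
        (∀ (Z : SingDelta) (f : C(Z, A 0)) (g : C(Z, A 1)), (δ 0).comp f = (δ 1).comp g →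
          X.pull f x = X.pull g y) → ∃ t : X.Sec M, X.pull α t = x ∧ X.pull β t = y := by
  obtain ⟨α, hα⟩ := exists_unionIncl_comp_eq δ (δ 0) fun t => ⟨0, t, rfl⟩
  obtain ⟨β, hβ⟩ := exists_unionIncl_comp_eq δ (δ 1) fun t => ⟨1, t, rfl⟩
  have hinj := unionIncl_injective δ
  have eα (f : C(A 0, unionRange δ)) (hf : (unionIncl δ).comp f = δ 0) : f = α :=
    ContinuousMap.ext fun x => hinj (DFunLike.congr_fun (hf.trans hα.symm) x)
  have eβ (f : C(A 1, unionRange δ)) (hf : (unionIncl δ).comp f = δ 1) : f = β :=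
    ContinuousMap.ext fun x => hinj (DFunLike.congr_fun (hf.trans hβ.symm) x)
  refine ⟨unionRange δ, unionIncl δ, α, β, hinj, hα, hβ,
    fun T g hg => exists_unionIncl_comp_eq δ g fun t => (hg t).elim (fun h => ⟨0, h⟩)
      fun h => ⟨1, h⟩,
    fun X => ⟨fun x y h₁ h₂ => union_ext δ hδ (Fin.forall_fin_two.2
      ⟨fun f hf => by rw [eα f hf]; exact h₁, fun f hf => by rw [eβ f hf]; exact h₂⟩),
      fun x y hxy => ?_⟩⟩
  have same (a : Fin 2) (Z : SingDelta) (f g : C(Z, A a)) (h : (δ a).comp f = (δ a).comp g)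
      (w : X.Sec (A a)) : X.pull f w = X.pull g w := by
    rw [ContinuousMap.ext fun z => hδ a (DFunLike.congr_fun h z)]
  let w : ∀ a, X.Sec (A a) := Fin.cons x (Fin.cons y fun a => a.elim0)
  obtain ⟨t, ht⟩ := exists_glue_union (X := X) δ hδ w
    (Fin.forall_fin_two.2
      ⟨Fin.forall_fin_two.2 ⟨fun Z f g h => same 0 Z f g h _, hxy⟩,
      Fin.forall_fin_two.2 ⟨fun Z f g h => (hxy Z g f h.symm).symm,
        fun Z f g h => same 1 Z f g h _⟩⟩)
  exact ⟨t, ht 0 α hα, ht 1 β hβ⟩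

lemma exists_union₂ {S P Q : SingDelta} (p : C(P, S)) (q : C(Q, S)) (hp : Function.Injective p)
    (hq : Function.Injective q) :
    ∃ (M : SingDelta) (j : C(M, S)) (α : C(P, M)) (β : C(Q, M)), Function.Injective j ∧
    j.comp α = p ∧ j.comp β = q ∧
    (∀ (T : SingDelta) (g : C(T, S)), (∀ t, (∃ x, p x = g t) ∨ ∃ x, q x = g t) →
      ∃ r : C(T, M), j.comp r = g) ∧
    ∀ X : QTop.{u},
      (∀ x y : X.Sec M, X.pull α x = X.pull α y → X.pull β x = X.pull β y → x = y) ∧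
      ∀ (x : X.Sec P) (y : X.Sec Q),
        (∀ (Z : SingDelta) (f : C(Z, P)) (g : C(Z, Q)), p.comp f = q.comp g →
          X.pull f x = X.pull g y) → ∃ t : X.Sec M, X.pull α t = x ∧ X.pull β t = y :=
  exists_union_of_fin_two (A := Fin.cons P (Fin.cons Q fun a => a.elim0))
    (Fin.cons (α := fun a => C((Fin.cons P (Fin.cons Q fun a => a.elim0) : Fin 2 → SingDelta) a, S))
      p (Fin.cons q fun a => a.elim0)) (Fin.forall_fin_two.2 ⟨hp, hq⟩)

end Pair

/-! ## The deformation retraction of a simplex onto a horn -/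

namespace HornRetraction

open QTop SingDelta Simplicial

variable {n : ℕ} (i : Fin (n + 2))

/-- The smallest coordinate different from the `i`-th one. -/
def minCoord (x : stdSimplex ℝ (Fin (n + 2))) : ℝ :=
  Finset.univ.inf' Finset.univ_nonempty fun a : Fin (n + 1) => x (i.succAbove a)

lemma continuous_minCoord : Continuous (minCoord i) :=
  Continuous.finset_inf'_apply _ fun _ _ => (continuous_apply _).comp continuous_subtype_val

lemma minCoord_nonneg (x : stdSimplex ℝ (Fin (n + 2))) : 0 ≤ minCoord i x :=
  Finset.le_inf' _ _ fun _ _ => stdSimplex.zero_le _ _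

lemma minCoord_le (x : stdSimplex ℝ (Fin (n + 2))) (a : Fin (n + 1)) :
    minCoord i x ≤ x (i.succAbove a) :=
  Finset.inf'_le _ (Finset.mem_univ a)

lemma exists_eq_minCoord (x : stdSimplex ℝ (Fin (n + 2))) :
    ∃ a : Fin (n + 1), x (i.succAbove a) = minCoord i x := by
  obtain ⟨a, _, ha⟩ := Finset.exists_mem_eq_inf' (Finset.univ_nonempty (α := Fin (n + 1)))
    fun a => x (i.succAbove a)
  exact ⟨a, ha.symm⟩

/-- A number, clamped to be nonnegative and at most the smallest coordinate. -/
def clamp (x : stdSimplex ℝ (Fin (n + 2))) (c : ℝ) : ℝ := max 0 (min c (minCoord i x))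

lemma clamp_eq {x : stdSimplex ℝ (Fin (n + 2))} {c : ℝ} (h₀ : 0 ≤ c) (h₁ : c ≤ minCoord i x) :
    clamp i x c = c := by
  rw [clamp, min_eq_left h₁, max_eq_right h₀]

lemma clamp_le (x : stdSimplex ℝ (Fin (n + 2))) (c : ℝ) : clamp i x c ≤ minCoord i x :=
  max_le (minCoord_nonneg i x) (min_le_right _ _)

/-- The coordinates of the point obtained by moving towards the `i`-th vertex. -/
def pushCoord (x : stdSimplex ℝ (Fin (n + 2))) (c : ℝ) (j : Fin (n + 2)) : ℝ :=
  -- The `n + 1` coordinates other than the `i`-th lose equal amounts and the `i`-th gains their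
  -- total. The direction is from the barycentre of the opposite face to the vertex; clamping keeps
  -- the point in the simplex for every real `c`.
  if j = i then x j + (n + 1) * clamp i x c else x j - clamp i x c

lemma pushCoord_mem (x : stdSimplex ℝ (Fin (n + 2))) (c : ℝ) :
    pushCoord i x c ∈ stdSimplex ℝ (Fin (n + 2)) := by
  have hc : 0 ≤ clamp i x c := le_max_left _ _
  constructor
  · intro j
    by_cases hj : j = i
    · rw [pushCoord, if_pos hj]
      have := stdSimplex.zero_le x j
      positivity
    · obtain ⟨a, rfl⟩ := Fin.exists_succAbove_eq hj
      rw [pushCoord, if_neg hj]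
      linarith [minCoord_le i x a, clamp_le i x c]
  · have h := stdSimplex.sum_eq_one x
    rw [Fin.sum_univ_succAbove _ i] at h ⊢
    simp only [pushCoord, if_true, Fin.succAbove_ne, if_false, Finset.sum_sub_distrib,
      Finset.sum_const, Finset.card_univ, Fintype.card_fin, nsmul_eq_mul]
    push_cast
    linarith

/-- The point obtained by moving towards the `i`-th vertex. -/
def push (x : stdSimplex ℝ (Fin (n + 2))) (c : ℝ) : stdSimplex ℝ (Fin (n + 2)) :=
  ⟨pushCoord i x c, pushCoord_mem i x c⟩

lemma continuous_push : Continuous fun p : stdSimplex ℝ (Fin (n + 2)) × ℝ => push i p.1 p.2 := by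
  have hc : Continuous fun p : stdSimplex ℝ (Fin (n + 2)) × ℝ => clamp i p.1 p.2 :=
    continuous_const.max (continuous_snd.min ((continuous_minCoord i).comp continuous_fst))
  refine Continuous.subtype_mk (continuous_pi fun j => ?_) _
  have hx : Continuous fun p : stdSimplex ℝ (Fin (n + 2)) × ℝ => p.1 j :=
    (continuous_apply j).comp (continuous_subtype_val.comp continuous_fst)
  by_cases hj : j = i
  · simp only [pushCoord, if_pos hj]
    exact hx.add (continuous_const.mul hc)
  · simp only [pushCoord, if_neg hj]
    exact hx.sub hc

lemma push_eq_self {x : stdSimplex ℝ (Fin (n + 2))} {c : ℝ} (h : clamp i x c = 0) :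
    push i x c = x := by
  ext j
  change pushCoord i x c j = x j
  by_cases hj : j = i
  · rw [pushCoord, if_pos hj, h, mul_zero, add_zero]
  · rw [pushCoord, if_neg hj, h, sub_zero]

lemma push_zero (x : stdSimplex ℝ (Fin (n + 2))) : push i x 0 = x :=
  push_eq_self i (clamp_eq i le_rfl (minCoord_nonneg i x))

lemma push_of_minCoord_eq_zero {x : stdSimplex ℝ (Fin (n + 2))} (h : minCoord i x = 0) (c : ℝ) :
    push i x c = x :=
  push_eq_self i (le_antisymm ((clamp_le i x c).trans h.le) (le_max_left _ _))

/-- Moving by exactly the smallest of these coordinates makes it vanish, so the point lands in the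
horn. -/
lemma exists_push_minCoord_eq_zero (x : stdSimplex ℝ (Fin (n + 2))) :
    ∃ a : Fin (n + 1), push i x (minCoord i x) (i.succAbove a) = 0 := by
  obtain ⟨a, ha⟩ := exists_eq_minCoord i x
  refine ⟨a, ?_⟩
  change pushCoord i x (minCoord i x) (i.succAbove a) = 0
  rw [pushCoord, if_neg (Fin.succAbove_ne i a), ha, clamp_eq i (minCoord_nonneg i x) le_rfl,
    sub_self]

/-- The simplex. -/
abbrev spx (n : ℕ) : SingDelta := simplexInclusion.obj ⦋n + 1⦌

/-- The smallest coordinate different from the `i`-th one, of a point of the simplex. -/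
def height : C(spx n, ℝ) :=
  ⟨fun x => minCoord i (simplexHomeo _ x), (continuous_minCoord i).comp (simplexHomeo _).continuous⟩

/-- Moving the points of the simplex towards the `i`-th vertex. -/
def move : C(spx n × ℝ, spx n) :=
  ⟨fun p => (simplexHomeo _).symm (push i (simplexHomeo _ p.1) p.2),
    (simplexHomeo _).symm.continuous.comp ((continuous_push i).comp
      (((simplexHomeo _).continuous.comp continuous_fst).prodMk continuous_snd))⟩

lemma height_nonneg (x : spx n) : 0 ≤ height i x := minCoord_nonneg i _

lemma move_zero (x : spx n) : move i (x, 0) = x :=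
  (congrArg (simplexHomeo _).symm (push_zero i _)).trans ((simplexHomeo _).symm_apply_apply x)

lemma move_of_height_eq_zero {x : spx n} (h : height i x = 0) (c : ℝ) : move i (x, c) = x :=
  (congrArg (simplexHomeo _).symm (push_of_minCoord_eq_zero i h c)).trans
    ((simplexHomeo _).symm_apply_apply x)

lemma exists_move_height_eq_zero (x : spx n) :
    ∃ a : Fin (n + 1), simplexHomeo (n + 1) (move i (x, height i x)) (i.succAbove a) = 0 := by
  obtain ⟨a, ha⟩ := exists_push_minCoord_eq_zero i (simplexHomeo _ x)
  refine ⟨a, Eq.trans ?_ ha⟩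
  exact congrArg (fun y : stdSimplex ℝ (Fin (n + 2)) => y (i.succAbove a))
    ((simplexHomeo (n + 1)).apply_symm_apply _)

lemma height_hornIncl (x : hornObj n i) : height i (hornIncl n i x) = 0 := by
  obtain ⟨a, ha⟩ := Set.mem_iUnion.1 x.2
  exact le_antisymm ((minCoord_le i _ a).trans (le_of_eq ha)) (height_nonneg i _)

/-- The deformation of the simplex to the horn. -/
def simplexHomotopy : C(spx n × unitInterval, spx n) :=
  (move i).comp ⟨fun p => (p.1, p.2 * height i p.1), by fun_prop⟩

lemma simplexHomotopy_zero (x : spx n) : simplexHomotopy i (x, 0) = x := by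
  refine Eq.trans ?_ (move_zero i x)
  exact congrArg (fun c : ℝ => move i (x, c)) (zero_mul _)

lemma simplexHomotopy_hornIncl (x : hornObj n i) (s : unitInterval) :
    simplexHomotopy i (hornIncl n i x, s) = hornIncl n i x :=
  move_of_height_eq_zero i (height_hornIncl i x) _

lemma exists_retraction : ∃ r : C(spx n, hornObj n i),
    ∀ x, hornIncl n i (r x) = simplexHomotopy i (x, 1) := by
  obtain ⟨r, hr⟩ := exists_hornIncl_comp_eq (i := i)
    ((simplexHomotopy i).comp ⟨fun x : spx n => (x, 1), by fun_prop⟩) (fun x => by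
      obtain ⟨a, ha⟩ := exists_move_height_eq_zero i x
      refine ⟨a, Eq.trans ?_ ha⟩
      have : simplexHomotopy i (x, 1) = move i (x, height i x) :=
        congrArg (fun c : ℝ => move i (x, c)) (one_mul _)
      exact congrArg (fun y => simplexHomeo (n + 1) y (i.succAbove a)) this)
  exact ⟨r, DFunLike.congr_fun hr⟩

/-! ### The deformation of the cylinder -/

/-- The height of the deformed point of the cylinder. -/
def newHeight : C((spx n × unitInterval) × unitInterval, unitInterval) :=
  -- The height is stretched by a factor that exceeds `1` away from the horn at positive times, and
  -- truncated at the top; the bottom stays at height `0`.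
  ⟨fun p => ⟨min 1 (p.1.2 * (1 + p.2 * height i p.1.1)), le_min zero_le_one
    (mul_nonneg p.1.2.2.1 (add_nonneg zero_le_one (mul_nonneg p.2.2.1 (height_nonneg i _)))),
    min_le_left _ _⟩, by fun_prop⟩

/-- The distance by which the base point of the deformed point of the cylinder is moved. -/
def distance : C((spx n × unitInterval) × unitInterval, ℝ) :=
  -- What the truncation cuts off the height is subtracted from the horizontal motion: nothing at
  -- the bottom, the whole motion at the top. The result lies between `0` and `height`, so `clamp`
  -- leaves it unchanged.
  ⟨fun p => p.2 * height i p.1.1 - max 0 (p.1.2 * (1 + p.2 * height i p.1.1) - 1), by fun_prop⟩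

/-- The deformation of the cylinder to the union of the cylinder on the horn and the top, in terms
of coordinates. -/
def prodHomotopy : C((spx n × unitInterval) × unitInterval, spx n × unitInterval) :=
  ((move i).comp ((ContinuousMap.fst.comp ContinuousMap.fst).prodMk (distance i))).prodMk
    (newHeight i)

lemma prodHomotopy_zero (x : spx n) (t : unitInterval) :
    prodHomotopy i ((x, t), 0) = (x, t) := by
  have h1 : distance i ((x, t), 0) = 0 := by
    simp [distance, t.2.2]
  refine Prod.ext ?_ (Subtype.ext ?_)
  · exact (congrArg (fun c => move i (x, c)) h1).trans (move_zero i x)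
  · simp [prodHomotopy, newHeight, t.2.2]

lemma prodHomotopy_of_height_eq_zero {x : spx n} (h : height i x = 0) (t s : unitInterval) :
    prodHomotopy i ((x, t), s) = (x, t) := by
  refine Prod.ext (move_of_height_eq_zero i h _) (Subtype.ext ?_)
  simp [prodHomotopy, newHeight, h, t.2.2]

/-- Keeps the two components of a track matched at height `0` when both are deformed. -/
lemma prodHomotopy_bottom (x : spx n) (s : unitInterval) :
    prodHomotopy i ((x, 0), s) = (simplexHomotopy i (x, s), 0) := by
  have h1 : distance i ((x, 0), s) = s * height i x := by
    simp [distance]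
  refine Prod.ext ?_ (Subtype.ext ?_)
  · exact congrArg (fun c => move i (x, c)) h1
  · simp [prodHomotopy, newHeight]

/-- Fixing the top preserves the prescribed image in `G^*`. -/
lemma prodHomotopy_top (x : spx n) (s : unitInterval) :
    prodHomotopy i ((x, 1), s) = (x, 1) := by
  have h0 : 0 ≤ s * height i x := mul_nonneg s.2.1 (height_nonneg i x)
  have h1 : distance i ((x, 1), s) = 0 := by
    simp [distance, h0]
  refine Prod.ext ?_ (Subtype.ext ?_)
  · exact (congrArg (fun c => move i (x, c)) h1).trans (move_zero i x)
  · simp [prodHomotopy, newHeight, h0]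

/-- If the stretched height is at most `1`, nothing was subtracted and the base point has travelled
all the way to the horn; otherwise the height was truncated to `1`. -/
lemma prodHomotopy_one (x : spx n) (t : unitInterval) :
    (∃ y : hornObj n i, hornIncl n i y = (prodHomotopy i ((x, t), 1)).1) ∨
      (prodHomotopy i ((x, t), 1)).2 = 1 := by
  rcases le_total (t * (1 + height i x)) 1 with h | h
  · left
    have h1 : distance i ((x, t), 1) = height i x := by
      simp [distance, h]
    obtain ⟨r, hr⟩ := exists_retraction i
    refine ⟨r x, (hr x).trans ?_⟩
    refine congrArg (fun c : ℝ => move i (x, c)) (Eq.trans ?_ h1.symm)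
    exact one_mul _
  · right
    refine Subtype.ext ?_
    simp [prodHomotopy, newHeight, h]

/-- The deformation of the cylinder to the union of the cylinder on the horn and the top. -/
def cylHomotopy : C((spx n).cyl × unitInterval, (spx n).cyl) :=
  (⟨(spx n).cylHomeo, (spx n).cylHomeo.continuous⟩ : C(spx n × unitInterval, _)).comp
    ((prodHomotopy i).comp
      (((⟨(spx n).cylHomeo.symm, (spx n).cylHomeo.symm.continuous⟩ :
        C((spx n).cyl, spx n × unitInterval))).prodMap (ContinuousMap.id unitInterval)))

lemma cylHomotopy_cylHomeo (p : spx n × unitInterval) (s : unitInterval) :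
    cylHomotopy i ((spx n).cylHomeo p, s) = (spx n).cylHomeo (prodHomotopy i (p, s)) :=
  congrArg (fun q => (spx n).cylHomeo (prodHomotopy i (q, s))) ((spx n).cylHomeo.symm_apply_apply p)

lemma cylHomotopy_zero (c : (spx n).cyl) : cylHomotopy i (c, 0) = c := by
  obtain ⟨p, rfl⟩ := (spx n).cylHomeo.surjective c
  exact (cylHomotopy_cylHomeo i p 0).trans (congrArg _ (prodHomotopy_zero i p.1 p.2))

lemma cylHomotopy_cylMap (c : (hornObj n i).cyl) (s : unitInterval) :
    cylHomotopy i (cylMap (hornIncl n i) c, s) = cylMap (hornIncl n i) c :=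
  (cylHomotopy_cylHomeo i _ s).trans
    (congrArg _ (prodHomotopy_of_height_eq_zero i (height_hornIncl i _) _ s))

lemma cylHomotopy_bottom (x : spx n) (s : unitInterval) :
    cylHomotopy i ((spx n).cylAt 0 x, s) = (spx n).cylAt 0 (simplexHomotopy i (x, s)) :=
  (cylHomotopy_cylHomeo i (x, 0) s).trans (congrArg _ (prodHomotopy_bottom i x s))

lemma cylHomotopy_top (x : spx n) (s : unitInterval) :
    cylHomotopy i ((spx n).cylAt 1 x, s) = (spx n).cylAt 1 x :=
  (cylHomotopy_cylHomeo i (x, 1) s).trans (congrArg _ (prodHomotopy_top i x s))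

lemma cylHomotopy_one (c : (spx n).cyl) :
    (∃ y : (hornObj n i).cyl, cylMap (hornIncl n i) y = cylHomotopy i (c, 1)) ∨
      ∃ x, (spx n).cylAt 1 x = cylHomotopy i (c, 1) := by
  obtain ⟨p, rfl⟩ := (spx n).cylHomeo.surjective c
  rw [cylHomotopy_cylHomeo]
  rcases prodHomotopy_one i p.1 p.2 with ⟨y, hy⟩ | h
  · refine Or.inl ⟨(hornObj n i).cylHomeo (y, (prodHomotopy i (p, 1)).2), ?_⟩
    refine cyl_ext ?_ ?_
    · rw [cylMap, cylBase_cylMk_apply, cylBase_cylHomeo, ← hy]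
      exact congrArg (hornIncl n i) (cylBase_cylHomeo (y, (prodHomotopy i (p, 1)).2))
    · rw [cylMap, cylHeight_cylMk_apply, cylHeight_cylHomeo, cylHeight_cylHomeo]
  · exact Or.inr ⟨(prodHomotopy i (p, 1)).1,
      congrArg (spx n).cylHomeo (Prod.ext rfl h.symm)⟩

lemma cylMap_injective {R S : SingDelta} {g : C(R, S)} (hg : Function.Injective g) :
    Function.Injective (cylMap g) := by
  intro x y h
  have h₁ := congrArg S.cylBase h
  have h₂ := congrArg S.cylHeight h
  rw [cylMap, cylBase_cylMk_apply, cylBase_cylMk_apply] at h₁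
  rw [cylMap, cylHeight_cylMk_apply, cylHeight_cylMk_apply] at h₂
  exact cyl_ext (hg h₁) h₂

lemma cylAt_injective {S : SingDelta} (t : unitInterval) : Function.Injective (S.cylAt t) :=
  fun _ _ h => congrArg Prod.fst (S.cylHomeo.injective h)

lemma cylBase_cylMap {R S : SingDelta} (e : C(R, S)) (c : R.cyl) :
    S.cylBase (cylMap e c) = e (R.cylBase c) :=
  cylBase_cylMk_apply (e.comp R.cylBase) R.cylHeight c

lemma cylHeight_cylMap {R S : SingDelta} (e : C(R, S)) (c : R.cyl) :
    S.cylHeight (cylMap e c) = R.cylHeight c :=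
  cylHeight_cylMk_apply (e.comp R.cylBase) R.cylHeight c

lemma cylBase_cylAt {S : SingDelta} (t : unitInterval) (x : S) : S.cylBase (S.cylAt t x) = x :=
  cylBase_cylMk_apply (ContinuousMap.id S) (ContinuousMap.const S t) x

lemma cylHeight_cylAt {S : SingDelta} (t : unitInterval) (x : S) :
    S.cylHeight (S.cylAt t x) = t :=
  cylHeight_cylMk_apply (ContinuousMap.id S) (ContinuousMap.const S t) x

lemma cylMap_cylAt {R S : SingDelta} (e : C(R, S)) (t : unitInterval) (x : R) :
    cylMap e (R.cylAt t x) = S.cylAt t (e x) := by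
  refine cyl_ext ?_ ?_
  · rw [cylBase_cylMap, cylBase_cylAt, cylBase_cylAt]
  · rw [cylHeight_cylMap, cylHeight_cylAt, cylHeight_cylAt]

/-- The cylinder on `R` meets the slice of height `t` only in the slice of `R`. Gluing over the box
therefore needs just one condition, on the horn at height `1`. -/
lemma exists_of_cylMap_comp_eq_cylAt_comp {R S T : SingDelta} {e : C(R, S)} {t : unitInterval}
    {f : C(T, R.cyl)} {g : C(T, S)} (h : (cylMap e).comp f = (S.cylAt t).comp g) :
    ∃ k : C(T, R), f = (R.cylAt t).comp k ∧ g = e.comp k := by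
  have h' (z : T) : cylMap e (f z) = S.cylAt t (g z) := DFunLike.congr_fun h z
  have h₁ (z : T) : e (R.cylBase (f z)) = g z := by
    rw [← cylBase_cylMap, h', cylBase_cylAt]
  have h₂ (z : T) : R.cylHeight (f z) = t := by
    rw [← cylHeight_cylMap e, h', cylHeight_cylAt]
  have h₃ (z : T) : f z = R.cylAt t (R.cylBase (f z)) :=
    cyl_ext (cylBase_cylAt t _).symm ((h₂ z).trans (cylHeight_cylAt t _).symm)
  exact ⟨R.cylBase.comp f, ContinuousMap.ext h₃, ContinuousMap.ext fun z => (h₁ z).symm⟩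

/-- The union of the cylinder on the horn and the top of the cylinder on the simplex: its
inclusion and the parts of which it consists, a retraction, and gluing. -/
lemma exists_boxRetraction : ∃ (M : SingDelta) (j : C(M, (spx n).cyl)) (r : C((spx n).cyl, M))
    (α : C((hornObj n i).cyl, M)) (β : C(spx n, M)), Function.Injective j ∧
    (∀ c, j (r c) = cylHomotopy i (c, 1)) ∧ j.comp α = cylMap (hornIncl n i) ∧
    j.comp β = (spx n).cylAt 1 ∧
    ∀ X : QTop.{u},
      (∀ x y : X.Sec M, X.pull α x = X.pull α y → X.pull β x = X.pull β y → x = y) ∧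
      ∀ (x : X.Sec (hornObj n i).cyl) (y : X.Sec (spx n)),
        X.pull ((hornObj n i).cylAt 1) x = X.pull (hornIncl n i) y →
        ∃ t : X.Sec M, X.pull α t = x ∧ X.pull β t = y := by
  obtain ⟨M, j, α, β, hj, hα, hβ, hr, hM⟩ := exists_union₂.{u} (cylMap (hornIncl n i))
    ((spx n).cylAt 1) (cylMap_injective (hornIncl_injective n i)) (cylAt_injective 1)
  obtain ⟨r, hr⟩ := hr _
    ((cylHomotopy i).comp ((ContinuousMap.id _).prodMk (ContinuousMap.const _ 1)))
    (cylHomotopy_one i)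
  refine ⟨M, j, r, α, β, hj, DFunLike.congr_fun hr, hα, hβ, fun X => ⟨(hM X).1,
    fun x y hxy => (hM X).2 x y fun Z f g h => ?_⟩⟩
  obtain ⟨k, rfl, rfl⟩ := exists_of_cylMap_comp_eq_cylAt_comp h
  exact (pull_pull _ _ _).symm.trans ((congrArg (X.pull k) hxy).trans (pull_pull _ _ _))

end HornRetraction
end

noncomputable section

/-! ## Extension of formal sections -/

section Extension

open QTop ContSheaf SingDelta

variable {B : TopCat.{u}} {F G : ContSheaf B} {U V W : Opens B} {M N S T : SingDelta}

/-- The family of maps given by a homotopy and a function on the base. -/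
def homotopyFam (H : C(S × unitInterval, T)) (χ : C(B, unitInterval)) (U : Opens B) :
    C(S × U, T) :=
  H.comp ((ContinuousMap.id S).prodMap (χ.comp ⟨Subtype.val, continuous_subtype_val⟩))

lemma ContSheaf.pb_pb (f : C(M, N)) (g : C(N, S)) (x : F.Sec U S) :
    F.pb f (F.pb g x) = F.pb (g.comp f) x := pull_pull f g x

lemma ContSheaf.pb_id (x : F.Sec U S) : F.pb (ContinuousMap.id S) x = x := pull_id x

namespace formalSections

lemma res_act_homotopyFam (h : U ≤ V) (H : C(S × unitInterval, T)) (χ : C(B, unitInterval))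
    (z : (formalSections.obj F).Sec V T) :
    (formalSections.obj F).res h (act (homotopyFam H χ V) z) =
      act (homotopyFam H χ U) ((formalSections.obj F).res h z) :=
  res_act h _ z

lemma act_homotopyFam_of_eq (H : C(S × unitInterval, T)) (χ : C(B, unitInterval)) (k : C(S, T))
    (h : ∀ x, ∀ p ∈ U, H (x, χ p) = k x) (z : (formalSections.obj F).Sec U T) :
    act (homotopyFam H χ U) z = (formalSections.obj F).pb k z := by
  rw [← act_fst]
  congr 1
  exact ContinuousMap.ext fun x => h x.1 x.2.1 x.2.2

lemma pb_act_homotopyFam (k : C(N, S)) (H : C(S × unitInterval, T)) (χ : C(B, unitInterval))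
    (z : (formalSections.obj F).Sec U T) :
    (formalSections.obj F).pb k (act (homotopyFam H χ U) z) =
      act (homotopyFam (H.comp (k.prodMap (ContinuousMap.id _))) χ U) z :=
  pb_act k _ z

/-- Extension of a formal section along a homotopy of the parameter space. -/
lemma exists_extension (hU : U ≤ V) (hW : W ≤ V) (hV : V ≤ U ⊔ W) (χ : C(B, unitInterval))
    (hχ : ∀ p ∈ U ⊓ W, χ p = 1) (H : C(S × unitInterval, S)) (j : C(M, S)) (r : C(S, M))
    (hH : ∀ x, j (r x) = H (x, 1)) (a : (formalSections.obj F).Sec U S)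
    (g : (formalSections.obj F).Sec V M)
    (h : (formalSections.obj F).pb j a = (formalSections.obj F).res hU g) :
    ∃ z : (formalSections.obj F).Sec V S,
      (formalSections.obj F).res hU z = act (homotopyFam H χ U) a ∧
      (formalSections.obj F).res hW z =
        (formalSections.obj F).pb r ((formalSections.obj F).res hW g) := by
  -- The overlap is where `χ = 1`: there the action is pullback along `H(-, 1) = j ∘ r`, and `a`
  -- pulled back along `j` is `g`.
  refine exists_glue₂ hU hW hV _ _ ?_
  rw [res_act_homotopyFam, act_homotopyFam_of_eq H χ (j.comp r)
    (fun x p hp => by rw [hχ p hp]; exact (hH x).symm), ← pb_pb]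
  rw [← res_pb, h, res_res, res_pb, res_res]

variable {hU : U ≤ V} {hW : W ≤ V} {χ : C(B, unitInterval)} {H : C(S × unitInterval, S)}
  {r : C(S, M)} {a : (formalSections.obj F).Sec U S} {g : (formalSections.obj F).Sec V M}
  {z : (formalSections.obj F).Sec V S}

/-- The map `k` lands where the homotopy is stationary, so the cutoff has no effect there. It is
used for the horn, the cylinder on the horn and the top. -/
lemma pb_extension (hV : V ≤ U ⊔ W)
    (hz₁ : (formalSections.obj F).res hU z = act (homotopyFam H χ U) a)
    (hz₂ : (formalSections.obj F).res hW z =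
      (formalSections.obj F).pb r ((formalSections.obj F).res hW g))
    (k : C(N, S)) (hk : ∀ x s, H (k x, s) = k x) (w : (formalSections.obj F).Sec V N)
    (h₁ : (formalSections.obj F).pb k a = (formalSections.obj F).res hU w)
    (h₂ : (formalSections.obj F).pb (r.comp k) g = w) : (formalSections.obj F).pb k z = w := by
  refine ext_of_cover₂ hU hW hV ?_ ?_
  · rw [res_pb, hz₁, pb_act_homotopyFam, act_homotopyFam_of_eq _ χ k (fun x p _ => hk x (χ p)), h₁]
  · rw [res_pb, hz₂, pb_pb, ← res_pb, h₂]

/-- Where `χ` vanishes the homotopy is at its initial stage, the identity, so `a` is untouched. -/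
lemma res_extension {A : Opens B} (hA : A ≤ U)
    (hz₁ : (formalSections.obj F).res hU z = act (homotopyFam H χ U) a)
    (hχ : ∀ p ∈ A, χ p = 0) (hH : ∀ x, H (x, 0) = x) :
    (formalSections.obj F).res (hA.trans hU) z = (formalSections.obj F).res hA a := by
  rw [← res_res hA hU, hz₁, res_act_homotopyFam, act_homotopyFam_of_eq _ χ (ContinuousMap.id S)
    (fun x p hp => by rw [hχ p hp]; exact hH x), pb_id]

end formalSections

/-- A function which vanishes near a closed set `K` and is `1` outside a closed subset of a given
neighbourhood of `K`. -/
lemma exists_cutoff [NormalSpace B] {K : Set B} (hK : IsClosed K) (hKU : K ⊆ U) (V : Opens B) :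
    ∃ (χ : C(B, unitInterval)) (A W : Opens B), K ⊆ A ∧ A ≤ U ∧ W ≤ V ∧ V ≤ U ⊔ W ∧
      (∀ p ∈ A, χ p = 0) ∧ ∀ p ∈ U ⊓ W, χ p = 1 := by
  -- Nest `K ⊆ A ⊆ closure A ⊆ A' ⊆ closure A' ⊆ U`, let `χ` be `0` on `closure A` and `1` off `A'`,
  -- and take `W = V \ closure A'`. Then `W` misses `A'`, while `V \ W` lies in `U`.
  obtain ⟨A, hA, hKA, hAU⟩ := normal_exists_closure_subset hK U.isOpen hKU
  obtain ⟨A', hA', hAA', hA'U⟩ := normal_exists_closure_subset isClosed_closure U.isOpen hAU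
  obtain ⟨f, hf0, hf1, hf⟩ := exists_continuous_zero_one_of_isClosed (s := closure A) (t := A'ᶜ)
    isClosed_closure hA'.isClosed_compl (Set.disjoint_compl_right_iff_subset.2 hAA')
  refine ⟨⟨fun p => ⟨f p, hf p⟩, f.continuous.subtype_mk _⟩, ⟨A, hA⟩,
    V ⊓ ⟨(closure A')ᶜ, isClosed_closure.isOpen_compl⟩, hKA, subset_closure.trans hAU, inf_le_left,
    fun p hp => ?_, fun p hp => Subtype.ext (hf0 (subset_closure hp)), fun p hp =>
      Subtype.ext (hf1 fun h => hp.2.2 (subset_closure h))⟩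
  by_cases h : p ∈ closure A'
  · exact Or.inl (hA'U h)
  · exact Or.inr ⟨hp, h⟩

end Extension

/-! ## The flexible track -/

-- Both components are extended by `exists_extension` with one common `χ`: the `F^*` part from the
-- horn to the simplex, the path part from the box to the cylinder.
open QTop ContSheaf SingDelta HornRetraction in
lemma isFlexibleExtension_flexibleTrack {B : TopCat.{u}} [NormalSpace B] [T2Space B]
    {F G : ContSheaf B} (f : F ⟶ G) : IsFlexibleExtension (flexibleTrack f) := by
  refine isFlexibleExtension_of_lift _ fun n i K U V hK hKU hUV e b a he ha hae => ?_
  obtain ⟨χ, A, W, hKA, hAU, hWV, hV, hχ0, hχ1⟩ := exists_cutoff hK hKU V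
  obtain ⟨ρ, hρ⟩ := exists_retraction i
  obtain ⟨M, j, r, α, β, hj, hr, hα, hβ, hM⟩ := exists_boxRetraction.{u} i
  have he' := (sap_mappingTrackMap e).symm.trans he
  have ha' := (sap_mappingTrackMap a).symm.trans ha
  -- Data on the box: the paths of `e` on the cylinder over the horn and `b` on the top, matched at
  -- height `1` because `e` lies over `b`.
  obtain ⟨g, hgα, hgβ⟩ : ∃ g : (formalSections.obj G).Sec V M,
      (formalSections.obj G).pb α g = trackPath e ∧ (formalSections.obj G).pb β g = b :=
    (hM ((formalSections.obj G).obj.obj (op V))).2 (trackPath e) b he'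
  have hag : (formalSections.obj G).pb j (trackPath a) = (formalSections.obj G).res hUV g := by
    refine (hM ((formalSections.obj G).obj.obj (op U))).1 _ _ ?_ ?_
    · change (formalSections.obj G).pb α ((formalSections.obj G).pb j (trackPath a)) =
        (formalSections.obj G).pb α ((formalSections.obj G).res hUV g)
      rw [pb_pb, hα, ← trackPath_pb, hae, ← res_trackPath, ← hgα, res_pb]
    · change (formalSections.obj G).pb β ((formalSections.obj G).pb j (trackPath a)) =
        (formalSections.obj G).pb β ((formalSections.obj G).res hUV g)
      rw [pb_pb, hβ]
      refine ha'.trans ?_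
      rw [← hgβ, res_pb]
  obtain ⟨φ, hφU, hφW⟩ := formalSections.exists_extension hUV hWV hV χ hχ1 (simplexHomotopy i)
    (hornIncl n i) ρ hρ (trackFst a) (trackFst e) (by rw [← trackFst_pb, hae, res_trackFst])
  obtain ⟨γ, hγU, hγW⟩ := formalSections.exists_extension hUV hWV hV χ hχ1 (cylHomotopy i) j r hr
    (trackPath a) g hag
  have hρι : ρ.comp (hornIncl n i) = ContinuousMap.id _ :=
    ContinuousMap.ext fun x => hornIncl_injective n i
      ((hρ _).trans (simplexHomotopy_hornIncl i x 1))
  have hrα : r.comp (cylMap (hornIncl n i)) = α := ContinuousMap.ext fun c =>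
    hj ((hr _).trans ((cylHomotopy_cylMap i c 1).trans (DFunLike.congr_fun hα c).symm))
  have hrβ : r.comp ((spx n).cylAt 1) = β := ContinuousMap.ext fun x =>
    hj ((hr _).trans ((cylHomotopy_top i x 1).trans (DFunLike.congr_fun hβ x).symm))
  -- On the bottom, the retraction onto the box is the retraction of the simplex onto the horn; this
  -- gives the matching at height `0` over `W`.
  have hr0 : r.comp ((spx n).cylAt 0) = (α.comp ((hornObj n i).cylAt 0)).comp ρ := by
    refine ContinuousMap.ext fun x => hj ((hr _).trans ((cylHomotopy_bottom i x 1).trans ?_))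
    rw [← hρ, ← cylMap_cylAt, ← hα]
    rfl
  -- Matching at height `0` is checked on `U`, where the two deformations agree along the bottom at
  -- every time `χ(p)`, and on `W`, where `hr0` applies.
  obtain ⟨z, rfl, rfl⟩ := exists_track (f := formalSections.map f) φ γ (by
    refine ext_of_cover₂ hUV hWV hV ?_ ?_
    · rw [← sap_res, hφU, res_pb, hγU, formalSections.sap_act, sap_trackFst,
        formalSections.act_pb, formalSections.pb_act_homotopyFam]
      congr 1
      exact ContinuousMap.ext fun p => (cylHomotopy_bottom i p.1 (χ p.2)).symm
    · rw [← sap_res, hφW, res_pb, hγW, sap_pb, sap_res, sap_trackFst, ← hgα, ← res_pb, ← res_pb,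
        ← res_pb, pb_pb, pb_pb, pb_pb, hr0]
      rfl)
  refine ⟨z, A, hKA, hAU, track_ext ?_ ?_, track_ext ?_ ?_, ?_⟩
  · rw [← res_trackFst, ← res_trackFst]
    exact formalSections.res_extension hAU hφU hχ0 (simplexHomotopy_zero i)
  · rw [← res_trackPath, ← res_trackPath]
    exact formalSections.res_extension hAU hγU hχ0 (cylHomotopy_zero i)
  · rw [trackFst_pb]
    refine formalSections.pb_extension hV hφU hφW _ (simplexHomotopy_hornIncl i) _ ?_ ?_
    · rw [← trackFst_pb, hae, res_trackFst]
    · rw [hρι, pb_id]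
  · rw [trackPath_pb]
    refine formalSections.pb_extension hV hγU hγW _ (cylHomotopy_cylMap i) _ ?_ ?_
    · rw [← trackPath_pb, hae, res_trackPath]
    · rw [hrα, hgα]
  · refine (sap_mappingTrackMap z).trans ?_
    refine formalSections.pb_extension hV hγU hγW _ (cylHomotopy_top i) _ ha' ?_
    rw [hrβ, hgβ]

-- In the absolute case this makes the condition over the target automatic.
open ContSheaf in
lemma subsingleton_sec_terminal {B : TopCat.{u}} (V : Opens B) (S : SingDelta) :
    Subsingleton ((⊤_ ContSheaf B).Sec V S) := by
  have : PreservesLimit (Functor.empty.{0} (ContSheaf B)) (secFunctor B V S) := by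
    unfold secFunctor
    infer_instance
  have h := (Types.isTerminalEquivUnique _) (IsTerminal.isTerminalObj (secFunctor B V S) _
    terminalIsTerminal)
  exact ⟨fun x y => (h.eq_default x).trans (h.eq_default y).symm⟩

-- The terminal target prescribes nothing, so no path coordinate is needed: the deformation of the
-- simplex onto the horn suffices.
open QTop ContSheaf SingDelta HornRetraction in
lemma isFlexible_formalSections {B : TopCat.{u}} [NormalSpace B] [T2Space B] (F : ContSheaf B) :
    IsFlexible (formalSections.obj F) := by
  refine isFlexibleExtension_of_lift _ fun n i K U V hK hKU hUV e b a he ha hae => ?_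
  obtain ⟨χ, A, W, hKA, hAU, hWV, hV, hχ0, hχ1⟩ := exists_cutoff hK hKU V
  obtain ⟨ρ, hρ⟩ := exists_retraction i
  obtain ⟨φ, hφU, hφW⟩ := formalSections.exists_extension hUV hWV hV χ hχ1 (simplexHomotopy i)
    (hornIncl n i) ρ hρ a e hae
  have hρι : ρ.comp (hornIncl n i) = ContinuousMap.id _ :=
    ContinuousMap.ext fun x => hornIncl_injective n i
      ((hρ _).trans (simplexHomotopy_hornIncl i x 1))
  refine ⟨φ, A, hKA, hAU, formalSections.res_extension hAU hφU hχ0 (simplexHomotopy_zero i),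
    formalSections.pb_extension hV hφU hφW _ (simplexHomotopy_hornIncl i) _ hae ?_,
    (subsingleton_sec_terminal V _).elim _ _⟩
  rw [hρι, pb_id]

end

theorem mainTheorem8 (B : TopCat.{u}) [NormalSpace B] [T2Space B] :
    (∀ (F G : ContSheaf B) (f : F ⟶ G), IsFlexibleExtension (flexibleTrack f)) ∧
      ∀ F : ContSheaf B, IsFlexible (formalSections.obj F) :=
  ⟨fun _ _ f => isFlexibleExtension_flexibleTrack f, isFlexible_formalSections⟩
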